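/- Consider the chain $$u_{n,xy}=\alpha_n u_{n,x}u_{n,y}+\beta_n u_{n,x}+\gamma_n u_{n,y}+\delta_n,\qquad n\in\mathbb Z,$$ where $\alpha_n=\alpha(u_{n+1},u_n,u_{n-1})$ and similarly for $\beta_n,\gamma_n,\delta_n$, the functions $\alpha,\beta,\gamma,\delta$ are analytic in a domain $D\subset\mathbb C^3$, and neither $\partial\alpha/\partial u_{n+1}$ nor $\partial\alpha/\partial u_{n-1}$ vanishes identically on $D$. Denote by $f_n$ the right-hand side of the chain and put $a_n=\alpha_nu_{n,x}+\gamma_n$. Let $D_x$ be the total $x$-derivative, let $$Y=\sum_i\Big(u_{i,y}\frac{\partial}{\partial u_i}+f_i\frac{\partial}{\partial u_{i,x}}+D_x(f_i)\frac{\partial}{\partial u_{i,xx}}+\cdots\Big),\qquad X_i=\frac{\partial}{\partial u_{i,y}},\qquad Y_i=[X_i,Y],$$ and define $$Z_0=Y_0,\quad Z_1=Y_1,\quad Z_2=Y_2,\quad Z_3=[Y_1,Y_0],\quad Z_4=[Y_2,Y_1],\quad Z_5=[Y_2,Z_3],\quad Z_m=[Y_1,Z_{m-3}]\ (m\ge 6).$$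 All linear combinations below have as coefficients locally analytic functions of finitely many of the variables $u_n,u_{n,x},u_{n,xx},\dots$ ($n\in\mathbb Z$). They are considered over a nonempty open set $U$ of values of the dynamical variables on which $(u_{n+1},u_n,u_{n-1})\in D$ for $n=0,1,2$. Let $k\ge0$. Suppose that on $U$ $$Z_{3k+2}=\lambda_kZ_{3k+1}+\mu_kZ_{3k}+\nu_kZ_{3k-1}+\cdots$$ is a linear combination of the previous members of the sequence, and that for no $j<k$ is $Z_{3j+2}$ a linear combination of the $Z_s$ with $s<3j+2$ on any nonempty open subset of $U$. Then $k\ge1$, and on $U$ the coefficient $\nu_k$ satisfies $$D_x(\nu_k)=-a_1\nu_k-\frac{k(k-1)}2\,Y_1(a_1)-(k-1)\,Y_1(a_0+a_2).$$ Suppose in addition that for some $M$ the first sequence $Y_0,\ Y_1,\ W_1=[Y_0,Y_1],\ W_{j+1}=[Y_0,W_j]$ terminates at $W_M$. That is, $Y_0,Y_1,W_1,\dots,W_{M-1}$ are linearly independent over the locally analytic functions on every open subset of $U$, and on $U$ the operator $W_M$ is a linear combination of them. Then $M=2$ and $k=2$. -/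

import Mathlib

open scoped Topology

noncomputable section

namespace QuasilinearChain

/-- Coefficients `α, β, γ, δ` of the chain
`u_{n,xy} = α u_{n,x} u_{n,y} + β u_{n,x} + γ u_{n,y} + δ`,
each a function of `(u_{n+1}, u_n, u_{n-1})`. -/
structure Chain where
  α : ℂ × ℂ × ℂ → ℂ
  β : ℂ × ℂ × ℂ → ℂ
  γ : ℂ × ℂ × ℂ → ℂ
  δ : ℂ × ℂ × ℂ → ℂ

/-- Dynamical variables: `Sum.inl (n, k)` stands for `∂_x^k u_n` and `Sum.inr n` for `u_{n,y}`. -/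
abbrev Var : Type := (ℤ × ℕ) ⊕ ℤ

/-- A point assigns a value to each dynamical variable (product topology). -/
abbrev Point : Type := Var → ℂ

/-- The variable `∂_x^k u_n`. -/
def ux (n : ℤ) (k : ℕ) (p : Point) : ℂ := p (Sum.inl (n, k))

/-- The variable `u_{n,y}`. -/
def uy (n : ℤ) (p : Point) : ℂ := p (Sum.inr n)

/-- The triple `(u_{n+1}, u_n, u_{n-1})`. -/
def triple (n : ℤ) (p : Point) : ℂ × ℂ × ℂ := (ux (n + 1) 0 p, ux n 0 p, ux (n - 1) 0 p)

/-- Partial derivative with respect to the dynamical variable `w`. -/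
def pd (w : Var) (F : Point → ℂ) (p : Point) : ℂ :=
  deriv (fun t : ℂ => F (Function.update p w t)) (p w)

/-- A vector field `∑ V_w ∂/∂w` on the space of dynamical variables, given by its coefficients. -/
abbrev VField : Type := Var → Point → ℂ

/-- The action of a vector field on a function; the sum is finite at every point
near which the function depends on finitely many dynamical variables. -/
def act (V : VField) (F : Point → ℂ) (p : Point) : ℂ := ∑ᶠ w : Var, V w p * pd w F p

/-- The commutator `[V, W]` of vector fields. -/
def bracket (V W : VField) : VField := fun w p => act V (W w) p - act W (V w) p

/-- `F` is, near each point of `U`, an analytic function of finitely many of the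
dynamical variables `u, u_x, u_xx, …`. -/
def LocAnalyticOn (F : Point → ℂ) (U : Set Point) : Prop :=
  ∀ p ∈ U, ∃ (S : Finset (ℤ × ℕ)) (g : (S → ℂ) → ℂ),
    AnalyticAt ℂ g (fun s => p (Sum.inl (s : ℤ × ℕ))) ∧
      ∀ᶠ q in 𝓝 p, F q = g (fun s => q (Sum.inl (s : ℤ × ℕ)))

/-- On `U`, the field `T m` is the linear combination `∑_{i < m} c_i T_i` of the previous members
of the sequence `T`, with coefficients that are locally analytic functions on `U`. -/
def IsExpansionOn (U : Set Point) (T : ℕ → VField) (m : ℕ) (c : ℕ → Point → ℂ) : Prop :=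
  (∀ i < m, LocAnalyticOn (c i) U) ∧
    ∀ p ∈ U, ∀ w : Var, T m w p = ∑ i ∈ Finset.range m, c i p * T i w p

/-- The fields `T 0, …, T (m - 1)` are linearly independent over the locally analytic functions,
on every part of `U`. -/
def LinIndepOn (U : Set Point) (T : ℕ → VField) (m : ℕ) : Prop :=
  ∀ V ⊆ U, IsOpen V → ∀ c : ℕ → Point → ℂ, (∀ i < m, LocAnalyticOn (c i) V) →
    (∀ p ∈ V, ∀ w : Var, ∑ i ∈ Finset.range m, c i p * T i w p = 0) →
      ∀ i < m, ∀ p ∈ V, c i p = 0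

namespace Chain

variable (C : Chain)

/-- The right-hand side `f_n` of the chain. -/
def f (n : ℤ) (p : Point) : ℂ :=
  C.α (triple n p) * ux n 1 p * uy n p + C.β (triple n p) * ux n 1 p
    + C.γ (triple n p) * uy n p + C.δ (triple n p)

/-- The function `a_n = α_n u_{n,x} + γ_n`. -/
def a (n : ℤ) (p : Point) : ℂ := C.α (triple n p) * ux n 1 p + C.γ (triple n p)

/-- The total derivative `D_x`; by virtue of the chain `D_x u_{n,y} = f_n`. -/
def Dx : VField
  | Sum.inl (n, k) => ux n (k + 1)
  | Sum.inr n => C.f n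

/-- The operator `Y = ∑ u_{i,y} ∂/∂u_i + f_i ∂/∂u_{i,x} + D_x(f_i) ∂/∂u_{i,xx} + …`, by which the
total derivative `D_y` acts on functions of `u, u_x, u_xx, …`. -/
def Y : VField
  | Sum.inl (n, 0) => uy n
  | Sum.inl (n, k + 1) => (act C.Dx)^[k] (C.f n)
  | Sum.inr _ => fun _ => 0

end Chain

/-- The operator `X_i = ∂/∂u_{i,y}`. -/
def X (i : ℤ) : VField := fun w _ => if w = Sum.inr i then 1 else 0

namespace Chain

variable (C : Chain)

/-- The operator `Y_i = [X_i, Y]`. -/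
def Yi (i : ℤ) : VField := bracket (X i) C.Y

/-- The sequence `Y_0, Y_1, W_1 = [Y_0, Y_1], W_2 = [Y_0, W_1], …`, so that `W_k` is its
member with number `k + 1`. -/
def seqW : ℕ → VField
  | 0 => C.Yi 0
  | 1 => C.Yi 1
  | n + 2 => bracket (C.Yi 0) (seqW (n + 1))

/-- The sequence `Z_m`. -/
def seqZ : ℕ → VField
  | 0 => C.Yi 0
  | 1 => C.Yi 1
  | 2 => C.Yi 2
  | 3 => bracket (C.Yi 1) (C.Yi 0)
  | 4 => bracket (C.Yi 2) (C.Yi 1)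
  | 5 => bracket (C.Yi 2) (bracket (C.Yi 1) (C.Yi 0))
  | n + 6 => bracket (C.Yi 1) (seqZ (n + 3))

end Chain

end QuasilinearChain

end

/-! On functions of `u, u_x, …` the operator `Y_i` is the derivation whose coefficient at `∂_x^j
u_i` is `(D_x + a_i)^j 1`; equivalently `[D_x, Y_i] = -a_i Y_i` (`dx_lie_yd`, `represents_Yi`). By
the Jacobi identity `ad D_x` is triangular on both sequences: each member is multiplied by minus a
weight, a sum of the `a_i`, modulo earlier members. Applying `ad D_x` to a linear relation and
comparing leading coefficients therefore gives equations `D_x c = A c + B` for its coefficients.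

A solution of such an equation depends on the `u_n` alone (`jet_of_dx_eq`), since a highest
derivative in `c` would produce a higher one in `D_x c`. The equation then prescribes every
`∂c/∂u_n`, and equality of cross derivatives constrains `α`.

For the equation of `ν_k` the coefficients at `Z_{3k-1}` must be compared although `Z_{3k}` and
`Z_{3k+1}` may be dependent on earlier members. A relation that involves `Z_{3k-1}` in an essential
way would yield `c ≠ 0` with `D_x c = (a_2 - a_1) c` or `D_x c = (a_0 - a_1) c`, and cross
derivatives exclude both because `α` really depends on `u_{n+1}` and `u_{n-1}`
(`Irreducible.top_three`, `Irreducible.top_four`).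

Termination of the first sequence at `W_M` gives, with `m = M - 1`, that `∂α_1/∂u_0 = m ∂α_0/∂u_1`,
that the mixed derivative of `α` in `u_{n+1}, u_{n-1}` vanishes, and that `v = ∂α/∂u_{n±1}`
satisfies the Liouville equation `(log v)_{xy} = -2v` in the two variables concerned
(`first_sequence_algebra`). Two proportional solutions of one Liouville equation are equal, so `m =
1` (`liouville_ratio`). The equation for `ν_k` then gives `∂α_2/∂u_1 = (k-1) ∂α_1/∂u_2` unless `k =
1`, and the same argument gives `k = 2`. The case `k = 1` is excluded by the equation for the
coefficient of `Z_4` in `Z_5` (`no_expansion_five`).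

The ring of locally analytic functions on an open set may have zero divisors, so each division is
made after passing to a smaller open set; the hypotheses are inherited by open subsets. -/

noncomputable section

namespace QuasilinearChain

/-! ### Calculus of functions of finitely many dynamical variables -/

/-- The values of the dynamical variables in a finite set. -/
def proj (S : Finset (ℤ × ℕ)) (q : Point) : S → ℂ := fun s => q (Sum.inl (s : ℤ × ℕ))

/-- Near `p`, the function `F` is the analytic function `g` of the variables in `S`. -/
def Rep (F : Point → ℂ) (p : Point) (S : Finset (ℤ × ℕ)) (g : (S → ℂ) → ℂ) : Prop :=
  AnalyticAt ℂ g (proj S p) ∧ ∀ᶠ q in 𝓝 p, F q = g (proj S q)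

/-- The pointwise version of `LocAnalyticOn`. -/
def LocAnalyticAt (F : Point → ℂ) (p : Point) : Prop := ∃ S g, Rep F p S g

lemma continuous_proj (S : Finset (ℤ × ℕ)) : Continuous (proj S) :=
  continuous_pi fun _ => continuous_apply _

lemma proj_update_mem {S : Finset (ℤ × ℕ)} {s : ℤ × ℕ} (hs : s ∈ S) (q : Point) (t : ℂ) :
    proj S (Function.update q (Sum.inl s) t) = Function.update (proj S q) ⟨s, hs⟩ t := by
  funext r
  by_cases h : r = ⟨s, hs⟩
  · subst h; simp [proj]
  · have : (r : ℤ × ℕ) ≠ s := fun h' => h (Subtype.ext h')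
    simp [proj, Function.update_of_ne h, this]

lemma proj_update_notMem {S : Finset (ℤ × ℕ)} {s : ℤ × ℕ} (hs : s ∉ S) (q : Point) (t : ℂ) :
    proj S (Function.update q (Sum.inl s) t) = proj S q := by
  funext r
  have : (r : ℤ × ℕ) ≠ s := fun h' => hs (h' ▸ r.2)
  simp [proj, this]

lemma proj_update_inr (S : Finset (ℤ × ℕ)) (n : ℤ) (q : Point) (t : ℂ) :
    proj S (Function.update q (Sum.inr n) t) = proj S q := by
  funext r
  simp [proj]

lemma tendsto_update (w : Var) (p : Point) :
    Filter.Tendsto (fun t : ℂ => Function.update p w t) (𝓝 (p w)) (𝓝 p) := by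
  have : Continuous fun t : ℂ => Function.update p w t := continuous_const.update w continuous_id
  simpa using this.tendsto (p w)

lemma pd_congr {F G : Point → ℂ} {p : Point} (h : F =ᶠ[𝓝 p] G) (w : Var) :
    pd w F p = pd w G p :=
  Filter.EventuallyEq.deriv_eq ((tendsto_update w p).eventually h)

namespace Rep

variable {F G : Point → ℂ} {p : Point} {S T : Finset (ℤ × ℕ)} {g : (S → ℂ) → ℂ}

lemma eventually (h : Rep F p S g) : ∀ᶠ q in 𝓝 p, Rep F q S g :=
  ((continuous_proj S).tendsto p |>.eventually h.1.eventually_analyticAt).and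
    h.2.eventually_nhds

lemma mono (h : Rep F p S g) (hST : S ⊆ T) :
    ∃ g' : (T → ℂ) → ℂ, Rep F p T g' := by
  let r : (T → ℂ) →L[ℂ] (S → ℂ) :=
    ContinuousLinearMap.pi fun s => ContinuousLinearMap.proj ⟨s, hST s.2⟩
  have hr : ∀ q, r (proj T q) = proj S q := fun q => rfl
  refine ⟨fun x => g (r x), ?_, ?_⟩
  · have h1 := h.1
    rw [← hr p] at h1
    exact h1.comp (r.analyticAt _)
  · filter_upwards [h.2] with q hq
    rw [hq, hr]

lemma locAnalyticAt (h : Rep F p S g) : LocAnalyticAt F p := ⟨S, g, h⟩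

lemma hasDerivAt_inl (h : Rep F p S g) {s : ℤ × ℕ} (hs : s ∈ S) :
    HasDerivAt (fun t : ℂ => F (Function.update p (Sum.inl s) t))
      (fderiv ℂ g (proj S p) (Pi.single ⟨s, hs⟩ 1)) (p (Sum.inl s)) := by
  have h1 : HasDerivAt (fun t : ℂ => Function.update (proj S p) ⟨s, hs⟩ t)
      (Pi.single ⟨s, hs⟩ 1) (p (Sum.inl s)) := hasDerivAt_update _ _ _
  have h0 : Function.update (proj S p) ⟨s, hs⟩ (p (Sum.inl s)) = proj S p := by
    rw [← proj_update_mem]; simp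
  have h2 : HasFDerivAt g (fderiv ℂ g (proj S p))
      (Function.update (proj S p) ⟨s, hs⟩ (p (Sum.inl s))) := by
    rw [h0]; exact h.1.differentiableAt.hasFDerivAt
  refine (h2.comp_hasDerivAt _ h1).congr_of_eventuallyEq ?_
  filter_upwards [(tendsto_update (Sum.inl s) p).eventually h.2] with t ht
  rw [ht, proj_update_mem hs]; rfl

lemma hasDerivAt_notMem (h : Rep F p S g) {w : Var} (hw : ∀ s ∈ S, w ≠ Sum.inl s) :
    HasDerivAt (fun t : ℂ => F (Function.update p w t)) 0 (p w) := by
  refine (hasDerivAt_const (p w) (g (proj S p))).congr_of_eventuallyEq ?_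
  filter_upwards [(tendsto_update w p).eventually h.2] with t ht
  rw [ht]
  congr 1
  cases w with
  | inl s => exact proj_update_notMem (fun hs => hw s hs rfl) _ _
  | inr n => exact proj_update_inr _ _ _ _

lemma pd_inl (h : Rep F p S g) {s : ℤ × ℕ} (hs : s ∈ S) :
    pd (Sum.inl s) F p = fderiv ℂ g (proj S p) (Pi.single ⟨s, hs⟩ 1) :=
  (h.hasDerivAt_inl hs).deriv

lemma pd_eq_zero (h : Rep F p S g) {w : Var} (hw : ∀ s ∈ S, w ≠ Sum.inl s) : pd w F p = 0 :=
  (h.hasDerivAt_notMem hw).deriv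

lemma pd_rep (h : Rep F p S g) {s : ℤ × ℕ} (hs : s ∈ S) :
    Rep (pd (Sum.inl s) F) p S (fun x => fderiv ℂ g x (Pi.single ⟨s, hs⟩ 1)) := by
  refine ⟨?_, ?_⟩
  · exact ((ContinuousLinearMap.apply ℂ ℂ (Pi.single (⟨s, hs⟩ : S) (1 : ℂ))).analyticAt _).comp
      h.1.fderiv
  · filter_upwards [h.eventually] with q hq
    exact hq.pd_inl hs

end Rep

lemma Rep.const (p : Point) (a : ℂ) : Rep (fun _ => a) p ∅ (fun _ => a) :=
  ⟨analyticAt_const, Filter.Eventually.of_forall fun _ => rfl⟩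

lemma Rep.coord (p : Point) (s : ℤ × ℕ) :
    Rep (fun q => q (Sum.inl s)) p {s} (fun x => x ⟨s, Finset.mem_singleton_self s⟩) :=
  ⟨(ContinuousLinearMap.proj (R := ℂ) (φ := fun _ : ({s} : Finset (ℤ × ℕ)) => ℂ)
    ⟨s, Finset.mem_singleton_self s⟩).analyticAt _, Filter.Eventually.of_forall fun _ => rfl⟩

lemma LocAnalyticAt.congr {F G : Point → ℂ} {p : Point} (h : LocAnalyticAt F p)
    (hFG : G =ᶠ[𝓝 p] F) : LocAnalyticAt G p := by
  obtain ⟨S, g, hg, hF⟩ := h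
  refine ⟨S, g, hg, ?_⟩
  filter_upwards [hF, hFG] with q h1 h2
  rw [h2, h1]

lemma locAnalyticAt_const (p : Point) (a : ℂ) : LocAnalyticAt (fun _ => a) p :=
  ⟨_, _, Rep.const p a⟩

lemma locAnalyticAt_coord (p : Point) (s : ℤ × ℕ) : LocAnalyticAt (fun q => q (Sum.inl s)) p :=
  ⟨_, _, Rep.coord p s⟩

namespace LocAnalyticAt

variable {F G : Point → ℂ} {p : Point}

lemma common (hF : LocAnalyticAt F p) (hG : LocAnalyticAt G p) :
    ∃ S g g', Rep F p S g ∧ Rep G p S g' := by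
  obtain ⟨S, g, hg⟩ := hF
  obtain ⟨T, g', hg'⟩ := hG
  obtain ⟨k, hk⟩ := hg.mono (Finset.subset_union_left (s₂ := T))
  obtain ⟨k', hk'⟩ := hg'.mono (Finset.subset_union_right (s₁ := S))
  exact ⟨_, k, k', hk, hk'⟩

lemma add (hF : LocAnalyticAt F p) (hG : LocAnalyticAt G p) : LocAnalyticAt (F + G) p := by
  obtain ⟨S, g, g', h, h'⟩ := hF.common hG
  refine ⟨S, g + g', h.1.add h'.1, ?_⟩
  filter_upwards [h.2, h'.2] with q h1 h2
  simp [h1, h2]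

lemma mul (hF : LocAnalyticAt F p) (hG : LocAnalyticAt G p) : LocAnalyticAt (F * G) p := by
  obtain ⟨S, g, g', h, h'⟩ := hF.common hG
  refine ⟨S, g * g', h.1.mul h'.1, ?_⟩
  filter_upwards [h.2, h'.2] with q h1 h2
  simp [h1, h2]

lemma inv (hF : LocAnalyticAt F p) (h0 : F p ≠ 0) : LocAnalyticAt (fun q => (F q)⁻¹) p := by
  obtain ⟨S, g, h⟩ := hF
  refine ⟨S, fun x => (g x)⁻¹, h.1.inv (h.2.self_of_nhds ▸ h0), ?_⟩
  filter_upwards [h.2] with q h1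
  simp [h1]

lemma sum {ι : Type*} (s : Finset ι) {f : ι → Point → ℂ} (h : ∀ i ∈ s, LocAnalyticAt (f i) p) :
    LocAnalyticAt (fun q => ∑ i ∈ s, f i q) p := by
  classical
  induction s using Finset.induction_on with
  | empty => simpa using locAnalyticAt_const p 0
  | insert a s ha ih =>
    have := (h a (Finset.mem_insert_self _ _)).add
      (ih fun i hi => h i (Finset.mem_insert_of_mem hi))
    simpa [Finset.sum_insert ha, Pi.add_def] using this

lemma continuousAt (hF : LocAnalyticAt F p) : ContinuousAt F p := by
  obtain ⟨S, g, h⟩ := hF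
  have h1 : ContinuousAt (fun q => g (proj S q)) p :=
    ContinuousAt.comp (f := proj S) h.1.continuousAt (continuous_proj S).continuousAt
  exact h1.congr (h.2.mono fun _ h => h.symm)

lemma differentiableAt (hF : LocAnalyticAt F p) (w : Var) :
    DifferentiableAt ℂ (fun t : ℂ => F (Function.update p w t)) (p w) := by
  obtain ⟨S, g, h⟩ := hF
  by_cases hw : ∀ s ∈ S, w ≠ Sum.inl s
  · exact (h.hasDerivAt_notMem hw).differentiableAt
  · push Not at hw
    obtain ⟨s, hs, rfl⟩ := hw
    exact (h.hasDerivAt_inl hs).differentiableAt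

lemma pd_add (hF : LocAnalyticAt F p) (hG : LocAnalyticAt G p) (w : Var) :
    pd w (F + G) p = pd w F p + pd w G p :=
  deriv_add (hF.differentiableAt w) (hG.differentiableAt w)

lemma pd_mul (hF : LocAnalyticAt F p) (hG : LocAnalyticAt G p) (w : Var) :
    pd w (F * G) p = F p * pd w G p + G p * pd w F p := by
  have := deriv_mul (hF.differentiableAt w) (hG.differentiableAt w)
  simp only [Function.update_eq_self] at this
  refine Eq.trans this ?_
  simp only [pd]; ring

lemma pd_inr (hF : LocAnalyticAt F p) (n : ℤ) : pd (Sum.inr n) F p = 0 := by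
  obtain ⟨S, g, h⟩ := hF
  exact h.pd_eq_zero (by simp)

lemma pd (hF : LocAnalyticAt F p) (w : Var) : LocAnalyticAt (pd w F) p := by
  obtain ⟨S, g, h⟩ := hF
  by_cases hw : ∀ s ∈ S, w ≠ Sum.inl s
  · refine (locAnalyticAt_const p 0).congr ?_
    filter_upwards [h.eventually] with q hq
    exact hq.pd_eq_zero hw
  · push Not at hw
    obtain ⟨s, hs, rfl⟩ := hw
    exact (h.pd_rep hs).locAnalyticAt

/-- In finitely many local variables this is the symmetry of the second derivative of an analytic
function; if one of the two variables does not occur, both sides vanish. -/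
lemma pd_comm (hF : LocAnalyticAt F p) (v w : Var) :
    QuasilinearChain.pd v (QuasilinearChain.pd w F) p =
      QuasilinearChain.pd w (QuasilinearChain.pd v F) p := by
  obtain ⟨S, g, h⟩ := hF
  have key : ∀ v w : Var, (∀ s ∈ S, v ≠ Sum.inl s) →
      QuasilinearChain.pd v (QuasilinearChain.pd w F) p =
      QuasilinearChain.pd w (QuasilinearChain.pd v F) p := by
    intro v w hv
    have h2 : QuasilinearChain.pd v F =ᶠ[𝓝 p] fun _ => 0 := by
      filter_upwards [h.eventually] with q hq
      exact hq.pd_eq_zero hv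
    rw [pd_congr h2 w]
    by_cases hw : ∀ s ∈ S, w ≠ Sum.inl s
    · have h3 : QuasilinearChain.pd w F =ᶠ[𝓝 p] fun _ => 0 := by
        filter_upwards [h.eventually] with q hq
        exact hq.pd_eq_zero hw
      rw [pd_congr h3 v]
      simp [QuasilinearChain.pd]
    · push Not at hw
      obtain ⟨s, hs, rfl⟩ := hw
      rw [(h.pd_rep hs).pd_eq_zero hv]
      simp [QuasilinearChain.pd]
  by_cases hv : ∀ s ∈ S, v ≠ Sum.inl s
  · exact key v w hv
  by_cases hw : ∀ s ∈ S, w ≠ Sum.inl s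
  · exact (key w v hw).symm
  push Not at hv hw
  obtain ⟨s, hs, rfl⟩ := hv
  obtain ⟨t, ht, rfl⟩ := hw
  rw [(h.pd_rep ht).pd_inl hs, (h.pd_rep hs).pd_inl ht]
  have hd : DifferentiableAt ℂ (fderiv ℂ g) (proj S p) := h.1.fderiv.differentiableAt
  rw [fderiv_clm_apply hd (differentiableAt_const _), fderiv_clm_apply hd (differentiableAt_const _)]
  have hs2 : IsSymmSndFDerivAt ℂ g (proj S p) :=
    ContDiffAt.isSymmSndFDerivAt_of_omega h.1.contDiffAt
  simpa using hs2 _ _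

end LocAnalyticAt

lemma Rep.act_eq {F : Point → ℂ} {p : Point} {S : Finset (ℤ × ℕ)} {g : (S → ℂ) → ℂ}
    (h : Rep F p S g) (V : VField) :
    act V F p = ∑ s ∈ S, V (Sum.inl s) p * pd (Sum.inl s) F p := by
  classical
  rw [act, finsum_eq_sum_of_support_subset (s := S.image Sum.inl)]
  · rw [Finset.sum_image fun _ _ _ _ h => Sum.inl_injective h]
  · intro w hw
    by_contra hS
    refine hw ?_
    have : pd w F p = 0 := h.pd_eq_zero fun s hs hws => hS (by simp [hws, hs])
    simp [this]

/-! ### The ring of locally analytic functions on an open set and its derivations -/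

open TopologicalSpace (Opens)

variable {U : Opens Point}

/-- Extension by zero. -/
def ext0 (F : U → ℂ) : Point → ℂ := Function.extend Subtype.val F 0

lemma ext0_apply (F : U → ℂ) (p : U) : ext0 F p = F p :=
  Subtype.val_injective.extend_apply _ _ _

/-- Partial derivatives see only germs, so at points of the open set `U` the arbitrary values
outside `U` do no harm. -/
lemma ext0_eventuallyEq {F : U → ℂ} {Φ : Point → ℂ} (h : ∀ p : U, F p = Φ p) {p : Point}
    (hp : p ∈ U) : ext0 F =ᶠ[𝓝 p] Φ := by
  filter_upwards [U.isOpen.mem_nhds hp] with q hq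
  rw [ext0_apply F ⟨q, hq⟩, h]

variable (U) in
/-- The algebra of locally analytic functions on an open set. -/
def locAnalyticSubalgebra : Subalgebra ℂ (U → ℂ) where
  carrier := {F | ∀ p ∈ U, LocAnalyticAt (ext0 F) p}
  mul_mem' {F G} hF hG p hp := ((hF p hp).mul (hG p hp)).congr
    (ext0_eventuallyEq (fun p => by simp [ext0_apply]) hp)
  add_mem' {F G} hF hG p hp := ((hF p hp).add (hG p hp)).congr
    (ext0_eventuallyEq (fun p => by simp [ext0_apply]) hp)
  algebraMap_mem' a p hp := (locAnalyticAt_const p a).congr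
    (ext0_eventuallyEq (fun p => by simp) hp)

variable (U) in
/-- The ring of locally analytic functions on an open set. -/
def O : Type := locAnalyticSubalgebra U

instance : CommRing (O U) := inferInstanceAs (CommRing (locAnalyticSubalgebra U))

instance : Algebra ℂ (O U) := inferInstanceAs (Algebra ℂ (locAnalyticSubalgebra U))

/-- Evaluation at a point. -/
def evAt (p : U) : O U →ₐ[ℂ] ℂ := 
  (Pi.evalAlgHom ℂ (fun _ : U => ℂ) p).comp (locAnalyticSubalgebra U).val

/-- A locally analytic function, extended by zero. -/
def ev (F : O U) : Point → ℂ := ext0 F.1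

lemma ev_eq (F : O U) (p : U) : ev F p = evAt p F := ext0_apply _ _

lemma O.ext_evAt {F G : O U} (h : ∀ p : U, evAt p F = evAt p G) : F = G :=
  Subtype.ext (funext h)

lemma ev_locAnalyticAt (F : O U) {p : Point} (hp : p ∈ U) : LocAnalyticAt (ev F) p := F.2 p hp

/-- A locally analytic function as an element of the algebra `O U`. -/
def O.mk (Φ : Point → ℂ) (h : ∀ p ∈ U, LocAnalyticAt Φ p) : O U :=
  ⟨fun p => Φ p, fun p hp => LocAnalyticAt.congr (h p hp) (ext0_eventuallyEq (fun _ => rfl) hp)⟩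

@[simp] lemma evAt_mk (Φ : Point → ℂ) (h : ∀ p ∈ U, LocAnalyticAt Φ p) (p : U) :
    evAt p (O.mk Φ h) = Φ p := rfl

lemma ev_mk_eventuallyEq (Φ : Point → ℂ) (h : ∀ p ∈ U, LocAnalyticAt Φ p) {p : Point} (hp : p ∈ U) :
    ev (O.mk Φ h) =ᶠ[𝓝 p] Φ := ext0_eventuallyEq (fun _ => rfl) hp

lemma ev_eventuallyEq {F : O U} {Φ : Point → ℂ} (h : ∀ p : U, evAt p F = Φ p) {p : Point}
    (hp : p ∈ U) : ev F =ᶠ[𝓝 p] Φ := ext0_eventuallyEq h hp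

/-- The dynamical variables as elements of `O U`. -/
def coord (s : ℤ × ℕ) : O U := O.mk (fun p => p (Sum.inl s)) fun p _ => locAnalyticAt_coord p s

@[simp] lemma evAt_coord (s : ℤ × ℕ) (p : U) : evAt p (coord s) = (p : Point) (Sum.inl s) := rfl

lemma act_congr (V : VField) {F G : Point → ℂ} {p : Point} (h : F =ᶠ[𝓝 p] G) :
    act V F p = act V G p := by
  simp only [act, pd_congr h]

lemma act_congr_left {V W : VField} {F : Point → ℂ} {p : Point} (hF : LocAnalyticAt F p)
    (h : ∀ s, V (Sum.inl s) p = W (Sum.inl s) p) : act V F p = act W F p := by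
  obtain ⟨S, g, hg⟩ := hF
  simp only [hg.act_eq, h]

lemma act_add (V : VField) {F G : Point → ℂ} {p : Point} (hF : LocAnalyticAt F p)
    (hG : LocAnalyticAt G p) : act V (F + G) p = act V F p + act V G p := by
  obtain ⟨S, g, g', h, h'⟩ := hF.common hG
  have h2 : Rep (F + G) p S (g + g') := by
    refine ⟨h.1.add h'.1, ?_⟩
    filter_upwards [h.2, h'.2] with q h1 h2
    simp [h1, h2]
  rw [h.act_eq, h'.act_eq, h2.act_eq, ← Finset.sum_add_distrib]
  exact Finset.sum_congr rfl fun s _ => by rw [hF.pd_add hG]; ring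

lemma act_mul (V : VField) {F G : Point → ℂ} {p : Point} (hF : LocAnalyticAt F p)
    (hG : LocAnalyticAt G p) : act V (F * G) p = F p * act V G p + G p * act V F p := by
  obtain ⟨S, g, g', h, h'⟩ := hF.common hG
  have h2 : Rep (F * G) p S (g * g') := by
    refine ⟨h.1.mul h'.1, ?_⟩
    filter_upwards [h.2, h'.2] with q h1 h2
    simp [h1, h2]
  rw [h.act_eq, h'.act_eq, h2.act_eq, Finset.mul_sum, Finset.mul_sum, ← Finset.sum_add_distrib]
  exact Finset.sum_congr rfl fun s _ => by rw [hF.pd_mul hG]; ring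

lemma act_const (V : VField) (a : ℂ) (p : Point) : act V (fun _ => a) p = 0 := by
  simp [act, pd]

/-- The vector field with the given coefficients at `∂/∂(∂_x^k u_n)`. -/
def vf (v : ℤ × ℕ → O U) : VField
  | Sum.inl s => ev (v s)
  | Sum.inr _ => fun _ => 0

lemma act_vf_locAnalyticAt (v : ℤ × ℕ → O U) {F : Point → ℂ} {p : Point} (hp : p ∈ U)
    (hF : LocAnalyticAt F p) : LocAnalyticAt (act (vf v) F) p := by
  obtain ⟨S, g, hg⟩ := hF
  refine LocAnalyticAt.congr (F := fun q => ∑ s ∈ S, ev (v s) q * pd (Sum.inl s) F q) ?_ ?_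
  · exact LocAnalyticAt.sum S fun s _ =>
      (ev_locAnalyticAt (v s) hp).mul (hg.locAnalyticAt.pd (Sum.inl s))
  · filter_upwards [hg.eventually] with q hq
    exact hq.act_eq _

/-- The function `∑ v_s ∂_s F`. -/
def actO (v : ℤ × ℕ → O U) (F : O U) : O U :=
  O.mk (act (vf v) (ev F)) fun _ hp => act_vf_locAnalyticAt v hp (ev_locAnalyticAt F hp)

lemma evAt_actO (v : ℤ × ℕ → O U) (F : O U) (p : U) :
    evAt p (actO v F) = act (vf v) (ev F) p := rfl

/-- The derivation of `O U` with the given values on the dynamical variables. -/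
def der (v : ℤ × ℕ → O U) : Derivation ℂ (O U) (O U) :=
  Derivation.mk'
    { toFun := actO v
      map_add' := fun F G => O.ext_evAt fun p => by
        have h : ev (F + G) =ᶠ[𝓝 (p : Point)] ev F + ev G :=
          ev_eventuallyEq (fun q => by simp [ev_eq]) p.2
        simp only [map_add, evAt_actO, act_congr _ h,
          act_add _ (ev_locAnalyticAt F p.2) (ev_locAnalyticAt G p.2)]
      map_smul' := fun a F => O.ext_evAt fun p => by
        have h : ev (a • F) =ᶠ[𝓝 (p : Point)] (fun _ => a) * ev F :=
          ev_eventuallyEq (fun q => by simp [ev_eq]) p.2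
        simp only [map_smul, evAt_actO, act_congr _ h, RingHom.id_apply,
          act_mul _ (locAnalyticAt_const _ a) (ev_locAnalyticAt F p.2), act_const, mul_zero,
          add_zero, smul_eq_mul] }
    fun F G => O.ext_evAt fun p => by
      have h : ev (F * G) =ᶠ[𝓝 (p : Point)] ev F * ev G :=
        ev_eventuallyEq (fun q => by simp [ev_eq]) p.2
      simp only [LinearMap.coe_mk, AddHom.coe_mk, evAt_actO, act_congr _ h, map_add, smul_eq_mul,
        map_mul, act_mul _ (ev_locAnalyticAt F p.2) (ev_locAnalyticAt G p.2), ev_eq]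

lemma evAt_der (v : ℤ × ℕ → O U) (F : O U) (p : U) : evAt p (der v F) = act (vf v) (ev F) p := rfl

lemma evAt_der_congr (v : ℤ × ℕ → O U) {F G : O U} {p : U} (h : ev F =ᶠ[𝓝 (p : Point)] ev G) :
    evAt p (der v F) = evAt p (der v G) := by
  rw [evAt_der, evAt_der, act_congr _ h]

lemma evAt_der_of_rep (v : ℤ × ℕ → O U) {F : O U} {p : U} {S g} (h : Rep (ev F) p S g) :
    evAt p (der v F) = ∑ s ∈ S, evAt p (v s) * pd (Sum.inl s) (ev F) p := by
  rw [evAt_der, h.act_eq]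
  exact Finset.sum_congr rfl fun s _ => by rw [vf, ev_eq]

lemma act_coord (V : VField) (s : ℤ × ℕ) (p : Point) :
    act V (fun q => q (Sum.inl s)) p = V (Sum.inl s) p := by
  rw [(Rep.coord p s).act_eq, Finset.sum_singleton]
  simp [pd]

@[simp] lemma der_coord (v : ℤ × ℕ → O U) (s : ℤ × ℕ) : der v (coord s) = v s :=
  O.ext_evAt fun p => by
    have h : ev (coord s) =ᶠ[𝓝 (p : Point)] fun q => q (Sum.inl s) :=
      ev_mk_eventuallyEq _ _ p.2
    rw [evAt_der, act_congr _ h, act_coord, vf, ev_eq]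

/-- The derivations `∑ v_s ∂_s`. -/
def IsVec (T : Derivation ℂ (O U) (O U)) : Prop := der (fun s => T (coord s)) = T

lemma isVec_der (v : ℤ × ℕ → O U) : IsVec (der v) := by simp [IsVec]

/-- Abstract derivations of `O U` are not known to be determined by their values on the coordinates;
those in `IsVec` are, which reduces operator identities to a check on coordinates. -/
lemma IsVec.ext {T T' : Derivation ℂ (O U) (O U)} (h : IsVec T) (h' : IsVec T')
    (hc : ∀ s, T (coord s) = T' (coord s)) : T = T' := by
  rw [← h, ← h']; simp only [hc]

lemma der_add (v w : ℤ × ℕ → O U) : der (v + w) = der v + der w := by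
  refine Derivation.ext fun F => O.ext_evAt fun p => ?_
  obtain ⟨S, g, hg⟩ := ev_locAnalyticAt F p.2
  simp [evAt_der_of_rep _ hg, Finset.sum_add_distrib, add_mul]

lemma der_smul (a : O U) (v : ℤ × ℕ → O U) : der (a • v) = a • der v := by
  refine Derivation.ext fun F => O.ext_evAt fun p => ?_
  obtain ⟨S, g, hg⟩ := ev_locAnalyticAt F p.2
  simp [evAt_der_of_rep _ hg, Finset.mul_sum, mul_assoc]

lemma der_zero : der (0 : ℤ × ℕ → O U) = 0 := by
  simpa using der_smul (0 : O U) 0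

lemma isVec_zero : IsVec (0 : Derivation ℂ (O U) (O U)) := der_zero

lemma IsVec.add {T T' : Derivation ℂ (O U) (O U)} (h : IsVec T) (h' : IsVec T') :
    IsVec (T + T') := by
  rw [← h, ← h', ← der_add]; exact isVec_der _

lemma IsVec.smul (a : O U) {T : Derivation ℂ (O U) (O U)} (h : IsVec T) : IsVec (a • T) := by
  rw [← h, ← der_smul]; exact isVec_der _

lemma IsVec.sum {ι : Type*} (s : Finset ι) {T : ι → Derivation ℂ (O U) (O U)}
    (h : ∀ i ∈ s, IsVec (T i)) : IsVec (∑ i ∈ s, T i) :=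
  Finset.sum_induction _ IsVec (fun _ _ => IsVec.add) isVec_zero h

/-- The partial derivative with respect to `∂_x^k u_n`. -/
def dpd (s : ℤ × ℕ) : Derivation ℂ (O U) (O U) := der (Pi.single s 1)

lemma evAt_dpd (s : ℤ × ℕ) (F : O U) (p : U) : evAt p (dpd s F) = pd (Sum.inl s) (ev F) p := by
  obtain ⟨S, g, hg⟩ := ev_locAnalyticAt F p.2
  rw [dpd, evAt_der_of_rep _ hg]
  by_cases hs : s ∈ S
  · rw [Finset.sum_eq_single_of_mem s hs]
    · simp
    · intro t _ hts; simp [Pi.single_eq_of_ne hts]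
  · rw [hg.pd_eq_zero (by rintro t ht h; exact hs (Sum.inl_injective h ▸ ht))]
    refine Finset.sum_eq_zero fun t ht => ?_
    have : t ≠ s := fun h => hs (h ▸ ht)
    simp [Pi.single_eq_of_ne this]

lemma ev_dpd_eventuallyEq (s : ℤ × ℕ) (F : O U) {p : Point} (hp : p ∈ U) :
    ev (dpd s F) =ᶠ[𝓝 p] pd (Sum.inl s) (ev F) := ev_eventuallyEq (evAt_dpd s F) hp

lemma dpd_comm (s t : ℤ × ℕ) (F : O U) : dpd s (dpd t F) = dpd t (dpd s F) :=
  O.ext_evAt fun p => by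
    rw [evAt_dpd, evAt_dpd, pd_congr (ev_dpd_eventuallyEq t F p.2),
      pd_congr (ev_dpd_eventuallyEq s F p.2), (ev_locAnalyticAt F p.2).pd_comm]

/-- The second-order terms cancel by `dpd_comm`. -/
lemma isVec_lie_der (v w : ℤ × ℕ → O U) :
    ⁅der v, der w⁆ = der (fun s => der v (w s) - der w (v s)) := by
  refine Derivation.ext fun F => O.ext_evAt fun p => ?_
  obtain ⟨S, g, hg⟩ := ev_locAnalyticAt F p.2
  -- The same finite set `S` serves on a whole neighbourhood of `p`, so the formula for `der v F`
  -- may be differentiated again.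
  have hloc : ∀ v : ℤ × ℕ → O U, ev (der v F) =ᶠ[𝓝 (p : Point)] ev (∑ s ∈ S, v s * dpd s F) := by
    intro v
    filter_upwards [hg.eventually, U.isOpen.mem_nhds p.2] with q hq hqU
    have := evAt_der_of_rep v (p := ⟨q, hqU⟩) hq
    rw [ev_eq _ ⟨q, hqU⟩, ev_eq _ ⟨q, hqU⟩, this]
    simp [evAt_dpd]
  have hS : ∀ v : ℤ × ℕ → O U, ∀ s ∈ S, evAt p (der v (dpd s F)) =
      ∑ t ∈ S, evAt p (v t) * evAt p (dpd t (dpd s F)) := by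
    intro v s hs
    rw [evAt_der, act_congr _ (ev_dpd_eventuallyEq s F p.2), (hg.pd_rep hs).act_eq]
    refine Finset.sum_congr rfl fun t _ => ?_
    rw [vf, ev_eq, evAt_dpd, pd_congr (ev_dpd_eventuallyEq s F p.2)]
  have h2 : ∀ v w : ℤ × ℕ → O U, evAt p (der v (der w F)) =
      ∑ s ∈ S, ∑ t ∈ S, evAt p (w s) * (evAt p (v t) * evAt p (dpd t (dpd s F))) +
      ∑ s ∈ S, evAt p (dpd s F) * evAt p (der v (w s)) := by
    intro v w
    rw [evAt_der_congr v (hloc w), map_sum, map_sum, ← Finset.sum_add_distrib]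
    refine Finset.sum_congr rfl fun s hs => ?_
    rw [Derivation.leibniz, map_add, smul_eq_mul, smul_eq_mul, map_mul, map_mul, hS v s hs,
      Finset.mul_sum]
  rw [Derivation.commutator_apply, map_sub, h2, h2, evAt_der_of_rep _ hg, Finset.sum_comm]
  have h3 : ∀ t ∈ S, ∀ s ∈ S, evAt p (w s) * (evAt p (v t) * evAt p (dpd t (dpd s F))) =
      evAt p (v t) * (evAt p (w s) * evAt p (dpd s (dpd t F))) := by
    intro t _ s _
    rw [dpd_comm]; ring
  rw [Finset.sum_congr rfl fun t ht => Finset.sum_congr rfl (h3 t ht), add_sub_add_left_eq_sub,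
    ← Finset.sum_sub_distrib]
  refine Finset.sum_congr rfl fun s _ => ?_
  rw [evAt_dpd, map_sub]; ring

lemma IsVec.lie {T T' : Derivation ℂ (O U) (O U)} (h : IsVec T) (h' : IsVec T') :
    IsVec ⁅T, T'⁆ := by
  rw [← h, ← h', isVec_lie_der]; exact isVec_der _

lemma IsVec.evAt {T : Derivation ℂ (O U) (O U)} (h : IsVec T) {V : VField} {p : U}
    (hV : ∀ s, V (Sum.inl s) p = evAt p (T (coord s))) {Φ : Point → ℂ} {F : O U}
    (hF : Φ =ᶠ[𝓝 (p : Point)] ev F) : act V Φ p = QuasilinearChain.evAt p (T F) := by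
  rw [act_congr _ hF, ← h, evAt_der]
  refine act_congr_left (ev_locAnalyticAt F p.2) fun s => ?_
  rw [hV, vf, ev_eq]

/-- The vector field `V`, restricted to `U`, is the derivation `T`. -/
structure Represents (V : VField) (T : Derivation ℂ (O U) (O U)) : Prop where
  isVec : IsVec T
  inl : ∀ s (p : U), V (Sum.inl s) p = evAt p (T (coord s))
  inr : ∀ n (p : U), V (Sum.inr n) p = 0

lemma Represents.eventuallyEq {V : VField} {T : Derivation ℂ (O U) (O U)} (h : Represents V T)
    (s : ℤ × ℕ) {p : Point} (hp : p ∈ U) : V (Sum.inl s) =ᶠ[𝓝 p] ev (T (coord s)) :=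
  (ev_eventuallyEq (fun q => (h.inl s q).symm) hp).symm

/-- The coefficients at `∂/∂u_{n,y}` vanish on `U`, and the other coefficients do not involve
`u_{n,y}`; so nothing is lost by passing to derivations of `O U`. -/
lemma Represents.bracket {V W : VField} {T T' : Derivation ℂ (O U) (O U)}
    (h : Represents V T) (h' : Represents W T') : Represents (bracket V W) ⁅T, T'⁆ where
  isVec := h.isVec.lie h'.isVec
  inl s p := by
    rw [QuasilinearChain.bracket, h.isVec.evAt (fun s => h.inl s p) (h'.eventuallyEq s p.2),
      h'.isVec.evAt (fun s => h'.inl s p) (h.eventuallyEq s p.2), Derivation.commutator_apply,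
      map_sub]
  inr n p := by
    have key : ∀ {V W : VField} {T' : Derivation ℂ (O U) (O U)}, Represents W T' →
        act V (W (Sum.inr n)) p = 0 := by
      intro V W T' h'
      have : W (Sum.inr n) =ᶠ[𝓝 (p : Point)] fun _ => 0 := by
        filter_upwards [U.isOpen.mem_nhds p.2] with q hq using h'.inr n ⟨q, hq⟩
      rw [act_congr _ this, act_const]
    rw [QuasilinearChain.bracket, key h', key h, sub_zero]

/-! ### Functions of `(u_{n+1}, u_n, u_{n-1})` -/

/-- The algebra of functions of three variables that are analytic on `D`. -/
def An (D : Set (ℂ × ℂ × ℂ)) : Subalgebra ℂ (ℂ × ℂ × ℂ → ℂ) where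
  carrier := {F | AnalyticOnNhd ℂ F D}
  mul_mem' := AnalyticOnNhd.mul
  add_mem' := AnalyticOnNhd.add
  algebraMap_mem' _ := analyticOnNhd_const

variable {D : Set (ℂ × ℂ × ℂ)}

lemma hasDerivAt_slice₁ {F : ℂ × ℂ × ℂ → ℂ} {q : ℂ × ℂ × ℂ} (h : AnalyticAt ℂ F q) :
    HasDerivAt (fun t : ℂ => F (t, q.2.1, q.2.2)) (fderiv ℂ F q (1, 0, 0)) q.1 :=
  HasFDerivAt.comp_hasDerivAt (l := F) q.1 h.differentiableAt.hasFDerivAt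
    ((hasDerivAt_id q.1).prodMk (hasDerivAt_const q.1 (q.2.1, q.2.2)))

lemma hasDerivAt_slice₂ {F : ℂ × ℂ × ℂ → ℂ} {q : ℂ × ℂ × ℂ} (h : AnalyticAt ℂ F q) :
    HasDerivAt (fun t : ℂ => F (q.1, t, q.2.2)) (fderiv ℂ F q (0, 1, 0)) q.2.1 :=
  HasFDerivAt.comp_hasDerivAt (l := F) q.2.1 h.differentiableAt.hasFDerivAt
    ((hasDerivAt_const q.2.1 q.1).prodMk
      ((hasDerivAt_id q.2.1).prodMk (hasDerivAt_const q.2.1 q.2.2)))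

lemma hasDerivAt_slice₃ {F : ℂ × ℂ × ℂ → ℂ} {q : ℂ × ℂ × ℂ} (h : AnalyticAt ℂ F q) :
    HasDerivAt (fun t : ℂ => F (q.1, q.2.1, t)) (fderiv ℂ F q (0, 0, 1)) q.2.2 :=
  HasFDerivAt.comp_hasDerivAt (l := F) q.2.2 h.differentiableAt.hasFDerivAt
    ((hasDerivAt_const q.2.2 q.1).prodMk
      ((hasDerivAt_const q.2.2 q.2.1).prodMk (hasDerivAt_id q.2.2)))

lemma analyticAt_fderiv_apply {F : ℂ × ℂ × ℂ → ℂ} {q : ℂ × ℂ × ℂ} (h : AnalyticAt ℂ F q)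
    (v : ℂ × ℂ × ℂ) : AnalyticAt ℂ (fun q => fderiv ℂ F q v) q :=
  ((ContinuousLinearMap.apply ℂ ℂ v).analyticAt _).comp h.fderiv

/-- The derivative with respect to the first variable. -/
def px (F : An D) : An D :=
  ⟨fun q => deriv (fun t : ℂ => F.1 (t, q.2.1, q.2.2)) q.1, fun q hq =>
    (analyticAt_fderiv_apply (F.2 q hq) (1, 0, 0)).congr
      ((F.2 q hq).eventually_analyticAt.mono fun _ h => (hasDerivAt_slice₁ h).deriv.symm)⟩

/-- The derivative with respect to the second variable. -/
def py (F : An D) : An D :=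
  ⟨fun q => deriv (fun t : ℂ => F.1 (q.1, t, q.2.2)) q.2.1, fun q hq =>
    (analyticAt_fderiv_apply (F.2 q hq) (0, 1, 0)).congr
      ((F.2 q hq).eventually_analyticAt.mono fun _ h => (hasDerivAt_slice₂ h).deriv.symm)⟩

/-- The derivative with respect to the third variable. -/
def pz (F : An D) : An D :=
  ⟨fun q => deriv (fun t : ℂ => F.1 (q.1, q.2.1, t)) q.2.2, fun q hq =>
    (analyticAt_fderiv_apply (F.2 q hq) (0, 0, 1)).congr
      ((F.2 q hq).eventually_analyticAt.mono fun _ h => (hasDerivAt_slice₃ h).deriv.symm)⟩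

/-- The indices of the variables `u_{n+1}, u_n, u_{n-1}`. -/
def tripleVars (n : ℤ) : Finset (ℤ × ℕ) := {(n + 1, 0), (n, 0), (n - 1, 0)}

lemma rep_triple {F : ℂ × ℂ × ℂ → ℂ} {n : ℤ} {p : Point} (h : AnalyticAt ℂ F (triple n p)) :
    Rep (fun q => F (triple n q)) p (tripleVars n)
      (fun x => F (x ⟨(n + 1, 0), by simp [tripleVars]⟩, x ⟨(n, 0), by simp [tripleVars]⟩,
        x ⟨(n - 1, 0), by simp [tripleVars]⟩)) := by
  refine ⟨?_, Filter.Eventually.of_forall fun q => rfl⟩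
  have hc : ∀ s : tripleVars n, AnalyticAt ℂ (fun x : tripleVars n → ℂ => x s)
      (proj (tripleVars n) p) := fun s =>
    (ContinuousLinearMap.proj (R := ℂ) (φ := fun _ : tripleVars n => ℂ) s).analyticAt _
  exact AnalyticAt.comp (g := F) (f := fun x : tripleVars n → ℂ =>
    (x ⟨(n + 1, 0), by simp [tripleVars]⟩, x ⟨(n, 0), by simp [tripleVars]⟩,
        x ⟨(n - 1, 0), by simp [tripleVars]⟩)) h ((hc _).prod ((hc _).prod (hc _)))

/-- The function `F(u_{n+1}, u_n, u_{n-1})`. -/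
def tau (n : ℤ) (h : ∀ p ∈ U, triple n p ∈ D) : An D →ₐ[ℂ] O U where
  toFun F := O.mk (fun q => F.1 (triple n q)) fun p hp => (rep_triple (F.2 _ (h p hp))).locAnalyticAt
  map_one' := rfl
  map_mul' _ _ := rfl
  map_zero' := rfl
  map_add' _ _ := rfl
  commutes' _ := rfl

lemma evAt_tau (n : ℤ) (h : ∀ p ∈ U, triple n p ∈ D) (F : An D) (p : U) :
    evAt p (tau n h F) = F.1 (triple n p) := rfl

lemma ev_tau_eventuallyEq (n : ℤ) (h : ∀ p ∈ U, triple n p ∈ D) (F : An D) {p : Point}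
    (hp : p ∈ U) : ev (tau n h F) =ᶠ[𝓝 p] fun q => F.1 (triple n q) :=
  ev_eventuallyEq (fun _ => rfl) hp

lemma IsVec.tau {T : Derivation ℂ (O U) (O U)} (hT : IsVec T) (n : ℤ)
    (h : ∀ p ∈ U, triple n p ∈ D) (F : An D) :
    T (tau n h F) = QuasilinearChain.tau n h (px F) * T (coord (n + 1, 0))
      + QuasilinearChain.tau n h (py F) * T (coord (n, 0))
      + QuasilinearChain.tau n h (pz F) * T (coord (n - 1, 0)) := by
  refine O.ext_evAt fun p => ?_
  conv_lhs => rw [← hT]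
  have h1 := rep_triple (F.2 _ (h p p.2))
  have e := ev_tau_eventuallyEq n h F p.2
  rw [evAt_der, act_congr _ e, h1.act_eq]
  have hn1 : (n + 1, 0) ∉ ({(n, 0), (n - 1, 0)} : Finset (ℤ × ℕ)) := by
    simp; omega
  have hn2 : (n, 0) ∉ ({(n - 1, 0)} : Finset (ℤ × ℕ)) := by
    simp; omega
  rw [tripleVars, Finset.sum_insert hn1, Finset.sum_insert hn2, Finset.sum_singleton]
  have e1 : pd (Sum.inl (n + 1, 0)) (fun q => F.1 (triple n q)) p = (px F).1 (triple n p) := by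
    have : n - 1 ≠ n + 1 := by omega
    simp [pd, px, triple, ux, this]
  have e2 : pd (Sum.inl (n, 0)) (fun q => F.1 (triple n q)) p = (py F).1 (triple n p) := by
    simp [pd, py, triple, ux]
  have e3 : pd (Sum.inl (n - 1, 0)) (fun q => F.1 (triple n q)) p = (pz F).1 (triple n p) := by
    have : n + 1 ≠ n - 1 := by omega
    have h3 : n ≠ n - 1 := by omega
    simp [pd, pz, triple, ux, this, h3]
  rw [e1, e2, e3]
  simp only [vf, ev_eq, map_add, map_mul, evAt_tau]
  ring

/-! ### The operators `D_x` and `Y_i` as derivations -/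

variable (U) in
/-- The total derivative `D_x`. -/
def dx : Derivation ℂ (O U) (O U) := der fun s => coord (s.1, s.2 + 1)

lemma isVec_dx : IsVec (dx U) := isVec_der _

@[simp] lemma dx_coord (s : ℤ × ℕ) : dx U (coord s) = coord (s.1, s.2 + 1) := der_coord _ _

lemma act_Dx (C : Chain) {Φ : Point → ℂ} {F : O U} {p : U} (hF : Φ =ᶠ[𝓝 (p : Point)] ev F) :
    act C.Dx Φ p = evAt p (dx U F) :=
  isVec_dx.evAt (fun s => by rw [dx_coord]; rfl) hF

@[simp] lemma dpd_coord (s t : ℤ × ℕ) : dpd (U := U) s (coord t) = if t = s then 1 else 0 := by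
  rw [dpd, der_coord, Pi.single_apply]

lemma isVec_dpd (s : ℤ × ℕ) : IsVec (dpd (U := U) s) := isVec_der _

/-- The coefficients of the operator `Y_i` with `[D_x, Y_i] = -a Y_i`. -/
def jets (a : O U) : ℕ → O U
  | 0 => 1
  | k + 1 => dx U (jets a k) + a * jets a k

/-- The operator `∂/∂u_i + a ∂/∂u_{i,x} + …` with `[D_x, Y_i] = -a Y_i`. -/
def yd (i : ℤ) (a : O U) : Derivation ℂ (O U) (O U) :=
  der fun s => if s.1 = i then jets a s.2 else 0

lemma isVec_yd (i : ℤ) (a : O U) : IsVec (yd i a) := isVec_der _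

lemma yd_coord (i : ℤ) (a : O U) (s : ℤ × ℕ) :
    yd i a (coord s) = if s.1 = i then jets a s.2 else 0 := der_coord _ _

lemma jets_one (a : O U) : jets a 1 = a := by simp [jets]

/-- On the coordinates of `u_i` this is the recursion that defines `jets`. -/
lemma dx_lie_yd (i : ℤ) (a : O U) : ⁅dx U, yd i a⁆ = -(a • yd i a) := by
  refine (isVec_dx.lie (isVec_yd i a)).ext ?_ fun s => ?_
  · exact neg_smul a (yd i a) ▸ (isVec_yd i a).smul (-a)
  · rw [Derivation.commutator_apply, dx_coord, yd_coord, yd_coord, Derivation.neg_apply,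
      Derivation.smul_apply, yd_coord, smul_eq_mul]
    split_ifs with h
    · rw [jets]; ring
    · simp

lemma yd_dx (i : ℤ) (a F : O U) : yd i a (dx U F) = dx U (yd i a F) + a * yd i a F := by
  have := congrArg (fun T : Derivation ℂ (O U) (O U) => T F) (dx_lie_yd i a)
  simp only [Derivation.commutator_apply, Derivation.neg_apply, Derivation.smul_apply,
    smul_eq_mul] at this
  linear_combination -this

lemma yd_jets_eq_zero (i : ℤ) {a b : O U} (h : yd i a b = 0) (k : ℕ) :
    yd i a (jets b k) = 0 := by
  induction k with
  | zero => simp [jets]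
  | succ k ih =>
    simp [jets, yd_dx, ih, h]

lemma yd_lie_yd_eq_zero {i j : ℤ} {a b : O U} (h : yd i a b = 0) (h' : yd j b a = 0) :
    ⁅yd i a, yd j b⁆ = 0 := by
  refine ((isVec_yd i a).lie (isVec_yd j b)).ext isVec_zero fun s => ?_
  rw [Derivation.commutator_apply, yd_coord, yd_coord, Derivation.zero_apply]
  split_ifs <;> simp [yd_jets_eq_zero, h, h']

/-- The functions `D_x^k f_i` depend on `u_{i,y}` and so lie outside `O U`. They are affine in
`u_{i,y}`, and this product rule is all that is needed about them. -/
lemma act_affine (V : VField) {A B Φ : Point → ℂ} {p : Point} (i : ℤ) (hA : LocAnalyticAt A p)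
    (hB : LocAnalyticAt B p) (hΦ : Φ =ᶠ[𝓝 p] fun q => A q * uy i q + B q) :
    (∀ w, pd w Φ p = uy i p * pd w A p + A p * (if w = Sum.inr i then 1 else 0) + pd w B p) ∧
    act V Φ p = uy i p * act V A p + A p * V (Sum.inr i) p + act V B p := by
  have hpd : ∀ w, pd w Φ p =
      uy i p * pd w A p + A p * (if w = Sum.inr i then 1 else 0) + pd w B p := by
    intro w
    have h1 : HasDerivAt (fun t : ℂ => uy i (Function.update p w t))
        (if w = Sum.inr i then 1 else 0) (p w) := by
      have := hasDerivAt_pi.1 (hasDerivAt_update p w (p w)) (Sum.inr i)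
      simpa [uy, Pi.single_apply, eq_comm] using this
    have h2 := (hA.differentiableAt w).hasDerivAt
    have h3 := (hB.differentiableAt w).hasDerivAt
    rw [pd_congr hΦ]
    refine ((h2.mul h1).add h3).deriv.trans ?_
    simp only [Function.update_eq_self, pd]
    ring
  refine ⟨hpd, ?_⟩
  classical
  obtain ⟨S, g, g', h, h'⟩ := hA.common hB
  let T : Finset Var := insert (Sum.inr i) (S.image Sum.inl)
  have hpd0 : ∀ {F g}, Rep F p S g → ∀ w ∉ T, pd w F p = 0 := fun hF w hw =>
    hF.pd_eq_zero fun s hs hws => hw (by simp [T, hws, hs])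
  have hact : ∀ {F : Point → ℂ}, (∀ w ∉ T, pd w F p = 0) →
      act V F p = ∑ w ∈ T, V w p * pd w F p := by
    intro F hF
    refine finsum_eq_sum_of_support_subset _ fun w hw => ?_
    by_contra hwT
    exact hw (by simp [hF w hwT])
  rw [hact (hpd0 h), hact (hpd0 h'), hact (F := Φ)]
  · have h4 : A p * V (Sum.inr i) p =
        ∑ w ∈ T, V w p * (A p * if w = Sum.inr i then 1 else 0) := by
      simp [T, mul_comm]
    rw [h4, Finset.mul_sum, ← Finset.sum_add_distrib, ← Finset.sum_add_distrib]
    exact Finset.sum_congr rfl fun w _ => by rw [hpd]; ring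
  · intro w hw
    have : w ≠ Sum.inr i := fun h => hw (by simp [T, h])
    simp [hpd, hpd0 h w hw, hpd0 h' w hw, this]

lemma f_update (C : Chain) {i n : ℤ} (hn : n ≠ i) (p : Point) (t : ℂ) :
    C.f n (Function.update p (Sum.inr i) t) = C.f n p := by
  simp [Chain.f, triple, ux, uy, hn]

lemma pd_inr_of_forall {F : Point → ℂ} {i : ℤ}
    (h : ∀ p t, F (Function.update p (Sum.inr i) t) = F p) (p : Point) :
    pd (Sum.inr i) F p = 0 := by
  simp [pd, h]

lemma iterate_Dx_f_update (C : Chain) {i n : ℤ} (hn : n ≠ i) (k : ℕ) (p : Point) (t : ℂ) :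
    (act C.Dx)^[k] (C.f n) (Function.update p (Sum.inr i) t) = (act C.Dx)^[k] (C.f n) p := by
  induction k generalizing p t with
  | zero => exact f_update C hn p t
  | succ k ih =>
    rw [Function.iterate_succ_apply']
    refine finsum_congr fun w => ?_
    by_cases hw : w = Sum.inr i
    · subst hw
      rw [pd_inr_of_forall ih, pd_inr_of_forall ih, mul_zero, mul_zero]
    · have h1 : pd w ((act C.Dx)^[k] (C.f n)) (Function.update p (Sum.inr i) t) =
          pd w ((act C.Dx)^[k] (C.f n)) p := by
        simp only [pd, Function.update_of_ne hw]
        congr 1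
        funext s
        rw [Function.update_comm (Ne.symm hw), ih]
      rw [h1]
      congr 1
      cases w with
      | inl s => simp [Chain.Dx, ux]
      | inr m =>
        have hm : m ≠ i := fun h => hw (by rw [h])
        exact f_update C hm p t

section Represent

variable {C : Chain} {i : ℤ} (h : ∀ p ∈ U, triple i p ∈ D) (α β γ δ : An D)

/-- The function `a_i = α_i u_{i,x} + γ_i`. -/
def ad (i : ℤ) (h : ∀ p ∈ U, triple i p ∈ D) (α γ : An D) : O U :=
  tau i h α * coord (i, 1) + tau i h γ

lemma evAt_ad (hα : α.1 = C.α) (hγ : γ.1 = C.γ) (p : U) : evAt p (ad i h α γ) = C.a i p := by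
  simp [ad, evAt_tau, Chain.a, ux, hα, hγ]

/-- Since `D_x u_{i,y} = f_i = a_i u_{i,y} + …`, applying `D_x` to `A u_{i,y} + B` turns `A` into
`D_x A + a_i A`, the recursion of `jets`. The shift to `k + 1` reflects `f_i = D_y u_{i,x}`. -/
lemma iterate_Dx_f (hα : α.1 = C.α) (hβ : β.1 = C.β) (hγ : γ.1 = C.γ) (hδ : δ.1 = C.δ) (k : ℕ) :
    ∃ B : O U, ∀ p : U, (act C.Dx)^[k] (C.f i) p =
      ev (jets (ad i h α γ) (k + 1)) p * uy i p + ev B p := by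
  induction k with
  | zero =>
    refine ⟨tau i h β * coord (i, 1) + tau i h δ, fun p => ?_⟩
    rw [Function.iterate_zero, id_eq, zero_add, jets_one, ev_eq, ev_eq, evAt_ad h α γ hα hγ]
    simp [evAt_tau, Chain.f, Chain.a, ux, hβ, hδ]
    ring
  | succ k ih =>
    obtain ⟨B, hB⟩ := ih
    refine ⟨dx U B + jets (ad i h α γ) (k + 1) * (tau i h β * coord (i, 1) + tau i h δ),
      fun p => ?_⟩
    rw [Function.iterate_succ_apply']
    have h1 := (act_affine C.Dx (Φ := (act C.Dx)^[k] (C.f i)) i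
      (ev_locAnalyticAt (jets (ad i h α γ) (k + 1)) p.2) (ev_locAnalyticAt B p.2) (by
        filter_upwards [U.isOpen.mem_nhds p.2] with q hq using hB ⟨q, hq⟩)).2
    rw [h1, act_Dx C (Filter.EventuallyEq.refl _ _), act_Dx C (Filter.EventuallyEq.refl _ _)]
    rw [jets.eq_2 _ (k + 1)]
    have hf : C.f i p = C.a i p * uy i p + (C.β (triple i p) * ux i 1 p + C.δ (triple i p)) := by
      simp only [Chain.f, Chain.a]; ring
    simp only [ev_eq, map_add, map_mul, evAt_ad h α γ hα hγ, evAt_tau, evAt_coord, hβ, hδ,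
      Chain.Dx, hf, ux]
    ring

/-- As `X_i` has constant coefficients, `[X_i, Y]` differentiates the coefficients of `Y` in
`u_{i,y}`, which picks out the slopes found in `iterate_Dx_f`. -/
lemma represents_Yi (hα : α.1 = C.α) (hβ : β.1 = C.β) (hγ : γ.1 = C.γ) (hδ : δ.1 = C.δ) :
    Represents (C.Yi i) (yd i (ad i h α γ)) where
  isVec := isVec_yd _ _
  inl s p := by
    obtain ⟨m, k⟩ := s
    have e1 : act C.Y (X i (Sum.inl (m, k))) p = 0 := by
      have : X i (Sum.inl (m, k)) = fun _ => 0 := by funext q; simp [X]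
      rw [this, act_const]
    have e2 : ∀ F : Point → ℂ, act (X i) F p = pd (Sum.inr i) F p := by
      intro F
      rw [act, finsum_eq_single _ (Sum.inr i) fun w hw => by simp [X, hw]]
      simp [X]
    rw [Chain.Yi, bracket, e1, e2, sub_zero, yd_coord]
    cases k with
    | zero =>
      by_cases hm : m = i
      · subst hm
        simp [Chain.Y, uy, pd, jets]
      · simp [Chain.Y, uy, pd, hm]
    | succ k =>
      by_cases hm : m = i
      · subst hm
        obtain ⟨B, hB⟩ := iterate_Dx_f h α β γ δ hα hβ hγ hδ k
        rw [Chain.Y, (act_affine C.Dx m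
          (ev_locAnalyticAt (jets (ad m h α γ) (k + 1)) p.2) (ev_locAnalyticAt B p.2) (by
          filter_upwards [U.isOpen.mem_nhds p.2] with q hq using hB ⟨q, hq⟩)).1,
          (ev_locAnalyticAt _ p.2).pd_inr, (ev_locAnalyticAt _ p.2).pd_inr]
        simp [ev_eq]
      · rw [Chain.Y, pd_inr_of_forall (iterate_Dx_f_update C hm k)]
        simp [hm]
  inr n p := by
    have h1 : C.Y (Sum.inr n) = fun _ => 0 := rfl
    have h2 : X i (Sum.inr n) = fun _ => if (Sum.inr n : Var) = Sum.inr i then 1 else 0 := rfl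
    rw [Chain.Yi, bracket, h1, h2, act_const, act_const, sub_zero]

end Represent

/-! ### The action of `ad D_x` on the two sequences -/

section LieRinehart

variable {A : Type*} [CommRing A] [Algebra ℂ A]

lemma lie_smul_der (f : A) (X Y : Derivation ℂ A A) : ⁅X, f • Y⁆ = X f • Y + f • ⁅X, Y⁆ := by
  ext a
  simp only [Derivation.commutator_apply, Derivation.smul_apply, Derivation.add_apply,
    Derivation.leibniz, smul_eq_mul]
  ring

lemma smul_lie_der (f : A) (X Y : Derivation ℂ A A) : ⁅f • X, Y⁆ = f • ⁅X, Y⁆ - Y f • X := by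
  rw [← lie_skew, lie_smul_der, ← lie_skew X Y, smul_neg]
  abel

/-- The span of the first `N` members of a sequence. -/
def low (Z : ℕ → Derivation ℂ A A) (N : ℕ) : Submodule A (Derivation ℂ A A) :=
  Submodule.span A (Z '' ↑(Finset.range N))

variable {Z : ℕ → Derivation ℂ A A} {N : ℕ}

lemma mem_low {s : ℕ} (h : s < N) : Z s ∈ low Z N :=
  Submodule.subset_span ⟨s, by simpa using h, rfl⟩

lemma low_mono {M N : ℕ} (h : M ≤ N) : low Z M ≤ low Z N :=
  Submodule.span_mono (Set.image_mono (by simpa using h))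

lemma mem_low_iff {x : Derivation ℂ A A} :
    x ∈ low Z N ↔ ∃ c : ℕ → A, ∑ i ∈ Finset.range N, c i • Z i = x :=
  Submodule.mem_span_image_finset_iff_exists_fun' A

lemma lie_mem_of_mem_low {X : Derivation ℂ A A} {M : Submodule A (Derivation ℂ A A)}
    (hM : low Z N ≤ M) (h : ∀ s < N, ⁅X, Z s⁆ ∈ M) {x : Derivation ℂ A A} (hx : x ∈ low Z N) :
    ⁅X, x⁆ ∈ M := by
  induction hx using Submodule.span_induction with
  | mem x hx =>
    obtain ⟨s, hs, rfl⟩ := hx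
    exact h s (by simpa using hs)
  | zero => simp
  | add x y _ _ hx hy => rw [lie_add]; exact M.add_mem hx hy
  | smul f x hx ih =>
    rw [lie_smul_der]
    exact M.add_mem (M.smul_mem _ (hM hx)) (M.smul_mem _ ih)

/-- The sequence `Z_m` built from three derivations. -/
def zseq (y₀ y₁ y₂ : Derivation ℂ A A) : ℕ → Derivation ℂ A A
  | 0 => y₀
  | 1 => y₁
  | 2 => y₂
  | 3 => ⁅y₁, y₀⁆
  | 4 => ⁅y₂, y₁⁆
  | 5 => ⁅y₂, ⁅y₁, y₀⁆⁆
  | n + 6 => ⁅y₁, zseq y₀ y₁ y₂ (n + 3)⁆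

/-- The sequence `Y_0, Y_1, [Y_0, Y_1], …` built from two derivations. -/
def wseq (y₀ y₁ : Derivation ℂ A A) : ℕ → Derivation ℂ A A
  | 0 => y₀
  | 1 => y₁
  | n + 2 => ⁅y₀, wseq y₀ y₁ (n + 1)⁆

/-- The relations between the total derivative and the operators `Y_0`, `Y_1`, `Y_2`. -/
structure ChainRelations (d y₀ y₁ y₂ : Derivation ℂ A A) (a₀ a₁ a₂ : A) : Prop where
  lie₀ : ⁅d, y₀⁆ = -(a₀ • y₀)
  lie₁ : ⁅d, y₁⁆ = -(a₁ • y₁)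
  lie₂ : ⁅d, y₂⁆ = -(a₂ • y₂)
  lie₂₀ : ⁅y₂, y₀⁆ = 0
  y₂a₀ : y₂ a₀ = 0
  y₀a₂ : y₀ a₂ = 0
  y₂y₁a₀ : y₂ (y₁ a₀) = 0
  y₀y₁a₂ : y₀ (y₁ a₂) = 0

/-- Jacobi identity: bracketing with `y` raises the weight `w` of `Z` by `a`. The correction `-y(w)
Z` is the source of the lower coefficients below. -/
lemma lie_lie_step {d y Z : Derivation ℂ A A} {a : A} (hy : ⁅d, y⁆ = -(a • y)) (w : A) :
    ⁅d, ⁅y, Z⁆⁆ + (w + a) • ⁅y, Z⁆ = Z a • y - y w • Z + ⁅y, ⁅d, Z⁆ + w • Z⁆ := by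
  rw [leibniz_lie d y Z, hy, neg_lie, smul_lie_der, lie_add, lie_smul_der]
  module

/-- Each bracketing with `y₀` adds `y₀` of the current weight to the subleading coefficient; summing
the weights `j a₀ + a₁`, `j ≤ m`, gives the binomial coefficient and `m + 1`. -/
lemma lie_wseq {d y₀ y₁ : Derivation ℂ A A} {a₀ a₁ : A} (h₀ : ⁅d, y₀⁆ = -(a₀ • y₀))
    (h₁ : ⁅d, y₁⁆ = -(a₁ • y₁)) (m : ℕ) :
    ⁅d, wseq y₀ y₁ (m + 2)⁆ + (((m : A) + 1) * a₀ + a₁) • wseq y₀ y₁ (m + 2) +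
      (((m + 1).choose 2 : A) * y₀ a₀ + (m + 1) * y₀ a₁) • wseq y₀ y₁ (m + 1) ∈
        low (wseq y₀ y₁) (m + 1) := by
  induction m with
  | zero =>
    have := lie_lie_step (Z := y₁) h₀ a₁
    rw [h₁, neg_add_cancel, lie_zero] at this
    have h2 : y₁ a₀ • y₀ ∈ low (wseq y₀ y₁) (0 + 1) :=
      Submodule.smul_mem _ _ (mem_low (Z := wseq y₀ y₁) (s := 0) (by norm_num))
    convert h2 using 1
    simp only [wseq, zero_add]
    have e : ⁅d, ⁅y₀, y₁⁆⁆ = y₁ a₀ • y₀ - y₀ a₁ • y₁ - (a₁ + a₀) • ⁅y₀, y₁⁆ := by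
      rw [← sub_eq_zero] at this ⊢
      rw [← this]
      module
    rw [e]
    simp
    module
  | succ m ih =>
    set W := wseq y₀ y₁
    set w : A := ((m : A) + 1) * a₀ + a₁
    set e : A := ((m + 1).choose 2 : A) * y₀ a₀ + (m + 1) * y₀ a₁
    set g := ⁅d, W (m + 2)⁆ + w • W (m + 2) + e • W (m + 1) with hg
    have hg' : ⁅d, W (m + 2)⁆ + w • W (m + 2) = g - e • W (m + 1) := by rw [hg]; abel
    have h1 := lie_lie_step (Z := W (m + 2)) h₀ w
    rw [hg', lie_sub, lie_smul_der] at h1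
    have hgl : ⁅y₀, g⁆ ∈ low W (m + 2) := by
      refine lie_mem_of_mem_low (low_mono (by omega)) (fun s hs => ?_) ih
      cases s with
      | zero =>
        have : ⁅y₀, W 0⁆ = 0 := lie_self y₀
        rw [this]; exact Submodule.zero_mem _
      | succ s =>
        exact mem_low (Z := W) (s := s + 2) (by omega)
    have hW : ⁅y₀, W (m + 2)⁆ = W (m + 3) := rfl
    have hW2 : ⁅y₀, W (m + 1)⁆ = W (m + 2) := rfl
    rw [hW, hW2] at h1
    have hc : ((m + 1 + 1).choose 2 : A) = ((m + 1).choose 2 : A) + (m + 1) := by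
      rw [Nat.choose_succ_succ' (m + 1) 1, Nat.choose_one_right]
      push_cast; ring
    have hyw : y₀ w = ((m : A) + 1) * y₀ a₀ + y₀ a₁ := by
      simp [w]
    have key : ⁅d, W (m + 3)⁆ + (((m + 1 : ℕ) : A) * a₀ + a₀ + a₁) • W (m + 3) +
        (((m + 1 + 1).choose 2 : A) * y₀ a₀ + (((m + 1 : ℕ) : A) + 1) * y₀ a₁) • W (m + 2) =
        W (m + 2) a₀ • W 0 - y₀ e • W (m + 1) + ⁅y₀, g⁆ := by
      have h2 : ⁅d, W (m + 3)⁆ = W (m + 2) a₀ • W 0 - y₀ w • W (m + 2) +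
          (⁅y₀, g⁆ - (y₀ e • W (m + 1) + e • W (m + 2))) - (w + a₀) • W (m + 3) :=
        eq_sub_of_add_eq h1
      rw [h2, hc, hyw]
      push_cast
      simp only [w, e]
      module
    have h3 : ((((m + 1 : ℕ) : A) + 1) * a₀ + a₁) = (((m + 1 : ℕ) : A) * a₀ + a₀ + a₁) := by ring
    rw [h3, key]
    refine Submodule.add_mem _ (Submodule.sub_mem _ ?_ ?_) hgl
    · exact Submodule.smul_mem _ _ (mem_low (by omega))
    · exact Submodule.smul_mem _ _ (mem_low (by omega))

/-- Apply `ad d` to the relation and cancel the leading term; the weights of the two top members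
differ by `a₀`, whence `a₀ * c`. -/
lemma wseq_relation {d y₀ y₁ : Derivation ℂ A A} {a₀ a₁ : A} (h₀ : ⁅d, y₀⁆ = -(a₀ • y₀))
    (h₁ : ⁅d, y₁⁆ = -(a₁ • y₁)) {m : ℕ} {c : A}
    (hc : wseq y₀ y₁ (m + 2) - c • wseq y₀ y₁ (m + 1) ∈ low (wseq y₀ y₁) (m + 1)) :
    (d c + a₀ * c + ((m + 1).choose 2 : A) * y₀ a₀ + (m + 1) * y₀ a₁) • wseq y₀ y₁ (m + 1) ∈
      low (wseq y₀ y₁) (m + 1) := by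
  set W := wseq y₀ y₁
  have hd : ∀ s, ∃ r ∈ low W (s + 1), ⁅d, W (s + 1)⁆ = r - ((s : A) * a₀ + a₁) • W (s + 1) := by
    intro s
    cases s with
    | zero =>
      refine ⟨0, Submodule.zero_mem _, ?_⟩
      simp [W, wseq, h₁]
    | succ s =>
      refine ⟨_, ?_, eq_sub_of_add_eq rfl⟩
      have h := lie_wseq h₀ h₁ s
      have h' := Submodule.sub_mem _ (low_mono (Nat.le_succ (s + 1)) h)
        (Submodule.smul_mem _ (((s + 1).choose 2 : A) * y₀ a₀ + (s + 1) * y₀ a₁)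
          (mem_low (Z := W) (Nat.lt_succ_self (s + 1))))
      rw [add_sub_cancel_right] at h'
      simpa using h'
  have hlow : ∀ x ∈ low W (m + 1), ⁅d, x⁆ ∈ low W (m + 1) := by
    refine fun x hx => lie_mem_of_mem_low le_rfl (fun s hs => ?_) hx
    cases s with
    | zero =>
      have : ⁅d, W 0⁆ = -(a₀ • W 0) := h₀
      rw [this]
      exact Submodule.neg_mem _ (Submodule.smul_mem _ _ (mem_low hs))
    | succ s =>
      obtain ⟨r, hr, e⟩ := hd s
      rw [e]
      exact Submodule.sub_mem _ (low_mono (by omega) hr) (Submodule.smul_mem _ _ (mem_low hs))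
  obtain ⟨r, hr, e⟩ := hd m
  have h1 := hlow _ hc
  have h2 := lie_wseq h₀ h₁ m
  rw [lie_sub, lie_smul_der, e] at h1
  have h3 := Submodule.sub_mem _ (Submodule.sub_mem _ (Submodule.add_mem _ h2
    (Submodule.smul_mem _ (-(((m : A) + 1) * a₀ + a₁)) hc)) h1) (Submodule.smul_mem _ c hr)
  convert h3 using 1
  module

variable {d y₀ y₁ y₂ : Derivation ℂ A A} {a₀ a₁ a₂ : A}

/-- The maximum matters only for `m = 0`, where `Z_2` has to be admitted because it occurs in `[D_x,
Z_4]`. -/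
lemma lie_zseq_low {m : ℕ} {x : Derivation ℂ A A}
    (hx : x ∈ low (zseq y₀ y₁ y₂) (max (3 * m + 2) 3)) :
    ⁅y₁, x⁆ ∈ low (zseq y₀ y₁ y₂) (3 * m + 5) := by
  refine lie_mem_of_mem_low (low_mono (by omega)) (fun s hs => ?_) hx
  match s with
  | 0 => exact mem_low (Z := zseq y₀ y₁ y₂) (s := 3) (by omega)
  | 1 => simp [zseq]
  | 2 =>
    have : ⁅y₁, zseq y₀ y₁ y₂ 2⁆ = - zseq y₀ y₁ y₂ 4 := (lie_skew _ _).symm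
    rw [this]
    exact Submodule.neg_mem _ (mem_low (by omega))
  | s + 3 => exact mem_low (Z := zseq y₀ y₁ y₂) (s := s + 6) (by omega)

variable (h : ChainRelations d y₀ y₁ y₂ a₀ a₁ a₂)

include h

lemma ChainRelations.lie₃ :
    ⁅d, ⁅y₁, y₀⁆⁆ = -(a₀ + a₁) • ⁅y₁, y₀⁆ + y₀ a₁ • y₁ - y₁ a₀ • y₀ := by
  rw [leibniz_lie, h.lie₁, h.lie₀, neg_lie, lie_neg, smul_lie_der, lie_smul_der]
  module

lemma ChainRelations.lie₄ :
    ⁅d, ⁅y₂, y₁⁆⁆ = -(a₁ + a₂) • ⁅y₂, y₁⁆ + y₁ a₂ • y₂ - y₂ a₁ • y₁ := by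
  rw [leibniz_lie, h.lie₁, h.lie₂, neg_lie, lie_neg, smul_lie_der, lie_smul_der]
  module

/-- Because `y₀` and `y₂` commute and kill each other's data, the only surviving second-order term
is `y₂ (y₀ a₁)`. -/
lemma ChainRelations.lie₅ :
    ⁅d, ⁅y₂, ⁅y₁, y₀⁆⁆⁆ = -(a₀ + a₁ + a₂) • ⁅y₂, ⁅y₁, y₀⁆⁆ + y₀ a₁ • ⁅y₂, y₁⁆
      - y₂ a₁ • ⁅y₁, y₀⁆ + y₂ (y₀ a₁) • y₁ := by
  rw [leibniz_lie, h.lie₂, h.lie₃, neg_lie, smul_lie_der, lie_sub, lie_add, lie_smul_der,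
    lie_smul_der, lie_smul_der, h.lie₂₀, h.y₂y₁a₀, map_neg, map_add, h.y₂a₀,
    Derivation.commutator_apply, h.y₀a₂, h.y₀y₁a₂, map_zero]
  module

lemma ChainRelations.lie_zseq_zero (m : ℕ) :
    ⁅d, zseq y₀ y₁ y₂ (3 * m + 3)⁆ + (((m : A) + 1) * a₁ + a₀) • zseq y₀ y₁ y₂ (3 * m + 3) ∈
      low (zseq y₀ y₁ y₂) (max (3 * m + 2) 3) := by
  set Z := zseq y₀ y₁ y₂
  induction m with
  | zero =>
    have e : ⁅d, Z 3⁆ + ((((0 : ℕ) : A) + 1) * a₁ + a₀) • Z 3 = y₀ a₁ • Z 1 - y₁ a₀ • Z 0 := by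
      have : ⁅d, Z 3⁆ = -(a₀ + a₁) • Z 3 + y₀ a₁ • Z 1 - y₁ a₀ • Z 0 := h.lie₃
      rw [this]; push_cast; module
    change ⁅d, Z 3⁆ + ((((0 : ℕ) : A) + 1) * a₁ + a₀) • Z 3 ∈ _
    rw [e]
    exact Submodule.sub_mem _ (Submodule.smul_mem _ _ (mem_low (by omega)))
      (Submodule.smul_mem _ _ (mem_low (by omega)))
  | succ m ih =>
    have h1 := lie_lie_step (Z := Z (3 * m + 3)) h.lie₁ (((m : A) + 1) * a₁ + a₀)
    have h2 : ⁅d, Z (3 * m + 6)⁆ + ((((m + 1 : ℕ) : A) + 1) * a₁ + a₀) • Z (3 * m + 6) =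
        ⁅d, Z (3 * m + 6)⁆ + ((((m : A) + 1) * a₁ + a₀) + a₁) • Z (3 * m + 6) := by
      push_cast; module
    replace h2 := h2.trans h1
    rw [show 3 * (m + 1) + 3 = 3 * m + 6 by ring, h2, show max (3 * (m + 1) + 2) 3 = 3 * m + 5 by omega]
    refine Submodule.add_mem _ (Submodule.sub_mem _ ?_ ?_) (lie_zseq_low ih)
    · exact Submodule.smul_mem _ _ (mem_low (Z := Z) (s := 1) (by omega))
    · exact Submodule.smul_mem _ _ (mem_low (by omega))

lemma ChainRelations.lie_zseq_one (m : ℕ) :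
    ⁅d, zseq y₀ y₁ y₂ (3 * m + 4)⁆ + (((m : A) + 1) * a₁ + a₂) • zseq y₀ y₁ y₂ (3 * m + 4) ∈
      low (zseq y₀ y₁ y₂) (max (3 * m + 2) 3) := by
  set Z := zseq y₀ y₁ y₂
  induction m with
  | zero =>
    have e : ⁅d, Z 4⁆ + ((((0 : ℕ) : A) + 1) * a₁ + a₂) • Z 4 = y₁ a₂ • Z 2 - y₂ a₁ • Z 1 := by
      have : ⁅d, Z 4⁆ = -(a₁ + a₂) • Z 4 + y₁ a₂ • Z 2 - y₂ a₁ • Z 1 := h.lie₄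
      rw [this]; push_cast; module
    change ⁅d, Z 4⁆ + ((((0 : ℕ) : A) + 1) * a₁ + a₂) • Z 4 ∈ _
    rw [e]
    exact Submodule.sub_mem _ (Submodule.smul_mem _ _ (mem_low (by omega)))
      (Submodule.smul_mem _ _ (mem_low (by omega)))
  | succ m ih =>
    have h1 := lie_lie_step (Z := Z (3 * m + 4)) h.lie₁ (((m : A) + 1) * a₁ + a₂)
    have h2 : ⁅d, Z (3 * m + 7)⁆ + ((((m + 1 : ℕ) : A) + 1) * a₁ + a₂) • Z (3 * m + 7) =
        ⁅d, Z (3 * m + 7)⁆ + ((((m : A) + 1) * a₁ + a₂) + a₁) • Z (3 * m + 7) := by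
      push_cast; module
    replace h2 := h2.trans h1
    rw [show 3 * (m + 1) + 4 = 3 * m + 7 by ring, h2, show max (3 * (m + 1) + 2) 3 = 3 * m + 5 by omega]
    refine Submodule.add_mem _ (Submodule.sub_mem _ ?_ ?_) (lie_zseq_low ih)
    · exact Submodule.smul_mem _ _ (mem_low (Z := Z) (s := 1) (by omega))
    · exact Submodule.smul_mem _ _ (mem_low (by omega))

/-- The terms in `Z_{3m+4}` and `Z_{3m+3}` are kept apart from the remainder since these operators
follow `Z_{3m+2}`, whose coefficient is the one of interest. That coefficient accumulates `y₁` of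
the successive weights. -/
lemma ChainRelations.lie_zseq_two (m : ℕ) :
    ⁅d, zseq y₀ y₁ y₂ (3 * m + 5)⁆ + (a₀ + ((m : A) + 1) * a₁ + a₂) • zseq y₀ y₁ y₂ (3 * m + 5)
      - y₀ a₁ • zseq y₀ y₁ y₂ (3 * m + 4) + y₂ a₁ • zseq y₀ y₁ y₂ (3 * m + 3)
      + (((m + 1).choose 2 : A) * y₁ a₁ + m * y₁ (a₀ + a₂)) • zseq y₀ y₁ y₂ (3 * m + 2) ∈
      low (zseq y₀ y₁ y₂) (max (3 * m + 2) 3) := by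
  set Z := zseq y₀ y₁ y₂
  induction m with
  | zero =>
    have : ⁅d, Z 5⁆ = -(a₀ + a₁ + a₂) • Z 5 + y₀ a₁ • Z 4 - y₂ a₁ • Z 3 + y₂ (y₀ a₁) • Z 1 :=
      h.lie₅
    change ⁅d, Z 5⁆ + (a₀ + (((0 : ℕ) : A) + 1) * a₁ + a₂) • Z 5 - y₀ a₁ • Z 4 + y₂ a₁ • Z 3
      + (((0 + 1).choose 2 : A) * y₁ a₁ + ((0 : ℕ) : A) * y₁ (a₀ + a₂)) • Z 2 ∈ _
    rw [this]
    have h2 : y₂ (y₀ a₁) • Z 1 ∈ low Z (max (3 * 0 + 2) 3) :=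
      Submodule.smul_mem _ _ (mem_low (by omega))
    convert h2 using 1
    simp
    module
  | succ m ih =>
    set w : A := a₀ + ((m : A) + 1) * a₁ + a₂ with hw
    set e : A := ((m + 1).choose 2 : A) * y₁ a₁ + m * y₁ (a₀ + a₂) with he
    set g := ⁅d, Z (3 * m + 5)⁆ + w • Z (3 * m + 5) - y₀ a₁ • Z (3 * m + 4)
      + y₂ a₁ • Z (3 * m + 3) + e • Z (3 * m + 2) with hg
    have hg' : ⁅d, Z (3 * m + 5)⁆ + w • Z (3 * m + 5) =
        g + y₀ a₁ • Z (3 * m + 4) - y₂ a₁ • Z (3 * m + 3) - e • Z (3 * m + 2) := by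
      rw [hg]; abel
    have h1 := lie_lie_step (Z := Z (3 * m + 5)) h.lie₁ w
    rw [hg', lie_sub, lie_sub, lie_add, lie_smul_der, lie_smul_der, lie_smul_der] at h1
    have hgl : ⁅y₁, g⁆ ∈ low Z (3 * m + 5) := lie_zseq_low ih
    have e5 : ⁅y₁, Z (3 * m + 5)⁆ = Z (3 * m + 8) := rfl
    have e4 : ⁅y₁, Z (3 * m + 4)⁆ = Z (3 * m + 7) := rfl
    have e3 : ⁅y₁, Z (3 * m + 3)⁆ = Z (3 * m + 6) := rfl
    -- For `m = 0` the bracket is `-Z 4` rather than `Z 5`, but then `e = 0`.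
    have e2 : e • ⁅y₁, Z (3 * m + 2)⁆ = e • Z (3 * m + 5) := by
      cases m with
      | zero => simp [he]
      | succ m => rfl
    rw [e5, e4, e3, e2] at h1
    have hc : ((m + 1 + 1).choose 2 : A) = ((m + 1).choose 2 : A) + (m + 1) := by
      rw [Nat.choose_succ_succ' (m + 1) 1, Nat.choose_one_right]
      push_cast; ring
    have hyw : y₁ w = ((m : A) + 1) * y₁ a₁ + y₁ (a₀ + a₂) := by
      simp [w]; ring
    have h2 : ⁅d, Z (3 * m + 8)⁆ = _ := eq_sub_of_add_eq h1
    have key : ⁅d, Z (3 * m + 8)⁆ + (a₀ + (((m + 1 : ℕ) : A) + 1) * a₁ + a₂) • Z (3 * m + 8)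
        - y₀ a₁ • Z (3 * m + 7) + y₂ a₁ • Z (3 * m + 6)
        + (((m + 1 + 1).choose 2 : A) * y₁ a₁ + ((m + 1 : ℕ) : A) * y₁ (a₀ + a₂)) • Z (3 * m + 5) =
        Z (3 * m + 5) a₁ • Z 1 + ⁅y₁, g⁆ + y₁ (y₀ a₁) • Z (3 * m + 4)
          - y₁ (y₂ a₁) • Z (3 * m + 3) - y₁ e • Z (3 * m + 2) := by
      have eZ : Z 1 = y₁ := rfl
      rw [h2, hc, hyw, eZ]
      push_cast
      simp only [hw, he]
      module
    have goal_eq : ⁅d, Z (3 * (m + 1) + 5)⁆ +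
        (a₀ + (((m + 1 : ℕ) : A) + 1) * a₁ + a₂) • Z (3 * (m + 1) + 5)
        - y₀ a₁ • Z (3 * (m + 1) + 4) + y₂ a₁ • Z (3 * (m + 1) + 3)
        + (((m + 1 + 1).choose 2 : A) * y₁ a₁ + ((m + 1 : ℕ) : A) * y₁ (a₀ + a₂)) •
          Z (3 * (m + 1) + 2) = _ := key
    rw [goal_eq, show max (3 * (m + 1) + 2) 3 = 3 * m + 5 by omega]
    refine Submodule.sub_mem _ (Submodule.sub_mem _ (Submodule.add_mem _ (Submodule.add_mem _ ?_ hgl)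
      ?_) ?_) ?_ <;> exact Submodule.smul_mem _ _ (mem_low (by omega))

lemma ChainRelations.lie_mem_low {N : ℕ} {x : Derivation ℂ A A}
    (hx : x ∈ low (zseq y₀ y₁ y₂) N) : ⁅d, x⁆ ∈ low (zseq y₀ y₁ y₂) N := by
  refine lie_mem_of_mem_low le_rfl (fun s hs => ?_) hx
  set Z := zseq y₀ y₁ y₂ with hZ
  have hlt : ∀ r ≤ s, ∀ c : A, c • Z r ∈ low Z N := fun r hr c =>
    Submodule.smul_mem _ _ (mem_low (by omega))
  match s with
  | 0 => exact h.lie₀ ▸ Submodule.neg_mem _ (hlt 0 le_rfl _)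
  | 1 => exact h.lie₁ ▸ Submodule.neg_mem _ (hlt 1 le_rfl _)
  | 2 => exact h.lie₂ ▸ Submodule.neg_mem _ (hlt 2 le_rfl _)
  | s + 3 =>
    obtain ⟨m, rfl | rfl | rfl⟩ : ∃ m, s = 3 * m ∨ s = 3 * m + 1 ∨ s = 3 * m + 2 :=
      ⟨s / 3, by omega⟩
    · have h1 := low_mono (Z := Z) (by omega : max (3 * m + 2) 3 ≤ N) (h.lie_zseq_zero m)
      have h2 := Submodule.sub_mem _ h1 (hlt (3 * m + 3) le_rfl (((m : A) + 1) * a₁ + a₀))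
      rwa [add_sub_cancel_right] at h2
    · have h1 := low_mono (Z := Z) (by omega : max (3 * m + 2) 3 ≤ N) (h.lie_zseq_one m)
      have h2 := Submodule.sub_mem _ h1 (hlt (3 * m + 4) le_rfl (((m : A) + 1) * a₁ + a₂))
      rwa [add_sub_cancel_right] at h2
    · have h1 := low_mono (Z := Z) (by omega : max (3 * m + 2) 3 ≤ N) (h.lie_zseq_two m)
      have h2 := Submodule.sub_mem _ (Submodule.add_mem _ (Submodule.sub_mem _
        (Submodule.sub_mem _ h1 (hlt (3 * m + 2) (by omega) (((m + 1).choose 2 : A) * y₁ a₁ + m * y₁ (a₀ + a₂))))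
          (hlt (3 * m + 3) (by omega) (y₂ a₁))) (hlt (3 * m + 4) (by omega) (y₀ a₁)))
          (hlt (3 * m + 5) (by omega) (a₀ + ((m : A) + 1) * a₁ + a₂))
      convert h2 using 1
      change ⁅d, Z (3 * m + 5)⁆ = _
      abel

/-- The weight of `Z_{3m+2}` modulo the previous members of the sequence. -/
lemma ChainRelations.lie_zseq_two' {m : ℕ} (hm : 1 ≤ m) :
    ⁅d, zseq y₀ y₁ y₂ (3 * m + 2)⁆ + (a₀ + (m : A) * a₁ + a₂) • zseq y₀ y₁ y₂ (3 * m + 2) ∈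
      low (zseq y₀ y₁ y₂) (3 * m + 2) := by
  obtain ⟨m, rfl⟩ : ∃ n, m = n + 1 := ⟨m - 1, by omega⟩
  set Z := zseq y₀ y₁ y₂ with hZ
  have hlt : ∀ r < 3 * (m + 1) + 2, ∀ c : A, c • Z r ∈ low Z (3 * (m + 1) + 2) := fun r hr c =>
    Submodule.smul_mem _ _ (mem_low (by omega))
  have h1 := low_mono (Z := Z) (by omega : max (3 * m + 2) 3 ≤ 3 * (m + 1) + 2) (h.lie_zseq_two m)
  have h2 := Submodule.add_mem _ (Submodule.sub_mem _ (Submodule.sub_mem _ h1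
    (hlt (3 * m + 2) (by omega) (((m + 1).choose 2 : A) * y₁ a₁ + m * y₁ (a₀ + a₂))))
    (hlt (3 * m + 3) (by omega) (y₂ a₁))) (hlt (3 * m + 4) (by omega) (y₀ a₁))
  convert h2 using 1
  rw [show 3 * (m + 1) + 2 = 3 * m + 5 by ring]
  push_cast
  abel

/-- The weights of `Z_{3m+3}` and `Z_{3m+2}` differ by `a₁ - a₂`. The bound `1 ≤ m` is needed
because `Z_2` has weight `a₂` and not `a₀ + a₂`. -/
lemma ChainRelations.relation_zero {m : ℕ} (hm : 1 ≤ m) {c : A}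
    (hc : zseq y₀ y₁ y₂ (3 * m + 3) - c • zseq y₀ y₁ y₂ (3 * m + 2) ∈
      low (zseq y₀ y₁ y₂) (3 * m + 2)) :
    (d c - (a₂ - a₁) * c) • zseq y₀ y₁ y₂ (3 * m + 2) ∈ low (zseq y₀ y₁ y₂) (3 * m + 2) := by
  have h1 := h.lie_mem_low hc
  have h2 := h.lie_zseq_zero m
  rw [max_eq_left (by omega)] at h2
  have h3 := h.lie_zseq_two' hm
  rw [lie_sub, lie_smul_der] at h1
  have h4 := Submodule.sub_mem _ (Submodule.sub_mem _ (Submodule.sub_mem _ h2 h1)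
    (Submodule.smul_mem _ c h3)) (Submodule.smul_mem _ (((m : A) + 1) * a₁ + a₀) hc)
  convert h4 using 1
  module

/-- The weights of `Z_{3m+4}` and `Z_{3m+2}` differ by `a₁ - a₀`. The coefficient `y` is left
unspecified: `Z_{3m+3}` may itself be dependent. -/
lemma ChainRelations.relation_one {m : ℕ} (hm : 1 ≤ m) {c e : A}
    (hc : zseq y₀ y₁ y₂ (3 * m + 4) - c • zseq y₀ y₁ y₂ (3 * m + 3)
      - e • zseq y₀ y₁ y₂ (3 * m + 2) ∈ low (zseq y₀ y₁ y₂) (3 * m + 2)) :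
    ∃ y : A, y • zseq y₀ y₁ y₂ (3 * m + 3) + (d e - (a₀ - a₁) * e) • zseq y₀ y₁ y₂ (3 * m + 2) ∈
      low (zseq y₀ y₁ y₂) (3 * m + 2) := by
  have h1 := h.lie_mem_low hc
  have h2 := h.lie_zseq_one m
  have h2' := h.lie_zseq_zero m
  rw [max_eq_left (by omega)] at h2 h2'
  have h3 := h.lie_zseq_two' hm
  rw [lie_sub, lie_sub, lie_smul_der, lie_smul_der] at h1
  have h4 := Submodule.sub_mem _ (Submodule.sub_mem _ (Submodule.sub_mem _ (Submodule.sub_mem _ h2 h1)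
    (Submodule.smul_mem _ e h3)) (Submodule.smul_mem _ (((m : A) + 1) * a₁ + a₂) hc))
    (Submodule.smul_mem _ c h2')
  refine ⟨d c + (a₂ - a₀) * c, ?_⟩
  convert h4 using 1
  module

/-- The weights of `Z_{3m+5}` and `Z_{3m+2}` differ by `a₁`; the remaining terms come from
`lie_zseq_two`. This is the equation for `ν_k` with `k = m + 1`, before its coefficient is shown to
vanish. -/
lemma ChainRelations.relation_two {m : ℕ} (hm : 1 ≤ m) {l u v : A}
    (hc : zseq y₀ y₁ y₂ (3 * m + 5) - l • zseq y₀ y₁ y₂ (3 * m + 4)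
      - u • zseq y₀ y₁ y₂ (3 * m + 3) - v • zseq y₀ y₁ y₂ (3 * m + 2) ∈
        low (zseq y₀ y₁ y₂) (3 * m + 2)) :
    ∃ x y : A, x • zseq y₀ y₁ y₂ (3 * m + 4) + y • zseq y₀ y₁ y₂ (3 * m + 3)
      + (d v + a₁ * v + ((m + 1).choose 2 : A) * y₁ a₁ + m * y₁ (a₀ + a₂)) •
        zseq y₀ y₁ y₂ (3 * m + 2) ∈ low (zseq y₀ y₁ y₂) (3 * m + 2) := by
  have h1 := h.lie_mem_low hc
  have h2 := h.lie_zseq_two m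
  have h2' := h.lie_zseq_one m
  have h2'' := h.lie_zseq_zero m
  rw [max_eq_left (by omega)] at h2 h2' h2''
  have h3 := h.lie_zseq_two' hm
  rw [lie_sub, lie_sub, lie_sub, lie_smul_der, lie_smul_der, lie_smul_der] at h1
  have h4 := Submodule.sub_mem _ (Submodule.sub_mem _ (Submodule.sub_mem _ (Submodule.sub_mem _
    (Submodule.sub_mem _ h2 h1)
    (Submodule.smul_mem _ v h3)) (Submodule.smul_mem _ (a₀ + ((m : A) + 1) * a₁ + a₂) hc))
    (Submodule.smul_mem _ l h2')) (Submodule.smul_mem _ u h2'')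
  refine ⟨d l + a₀ * l - y₀ a₁, d u + a₂ * u + y₂ a₁, ?_⟩
  convert h4 using 1
  module

lemma ChainRelations.relation_five {l : A}
    (hc : zseq y₀ y₁ y₂ 5 - l • zseq y₀ y₁ y₂ 4 ∈ low (zseq y₀ y₁ y₂) 4) :
    (d l + a₀ * l - y₀ a₁) • zseq y₀ y₁ y₂ 4 ∈ low (zseq y₀ y₁ y₂) 4 := by
  have h1 := h.lie_mem_low hc
  set Z := zseq y₀ y₁ y₂ with hZ
  have h2 : ⁅d, Z 5⁆ = -(a₀ + a₁ + a₂) • Z 5 + y₀ a₁ • Z 4 - y₂ a₁ • Z 3 + y₂ (y₀ a₁) • Z 1 :=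
      h.lie₅
  have h3 : ⁅d, Z 4⁆ = -(a₁ + a₂) • Z 4 + y₁ a₂ • Z 2 - y₂ a₁ • Z 1 := h.lie₄
  rw [lie_sub, lie_smul_der, h2, h3] at h1
  have hlt : ∀ r < 4, ∀ c : A, c • Z r ∈ low Z 4 := fun r hr c =>
    Submodule.smul_mem _ _ (mem_low (by omega))
  have h4 := Submodule.sub_mem _ (Submodule.sub_mem _ (Submodule.sub_mem _ (Submodule.add_mem _
    (Submodule.smul_mem _ (-(a₀ + a₁ + a₂)) hc) (hlt 1 (by omega) (y₂ (y₀ a₁) + l * y₂ a₁)))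
    (hlt 3 (by omega) (y₂ a₁))) (hlt 2 (by omega) (l * y₁ a₂))) h1
  convert h4 using 1
  module

end LieRinehart

/-! ### The equation `D_x c = A c + B` -/

lemma dpd_succ_dx (n : ℤ) (k : ℕ) (F : O U) :
    dpd (n, k + 1) (dx U F) = dx U (dpd (n, k + 1) F) + dpd (n, k) F := by
  have h : ⁅dpd (U := U) (n, k + 1), dx U⁆ = dpd (n, k) := by
    refine ((isVec_dpd _).lie isVec_dx).ext (isVec_dpd _) fun s => ?_
    rw [Derivation.commutator_apply, dx_coord, dpd_coord, dpd_coord, dpd_coord]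
    obtain ⟨m, j⟩ := s
    have : ∀ q : Prop, [Decidable q] → dx U (if q then 1 else 0) = 0 := by
      intro q _; split_ifs <;> simp
    rw [this]
    simp
  have := congrArg (fun T : Derivation ℂ (O U) (O U) => T F) h
  simp only [Derivation.commutator_apply] at this
  linear_combination this

lemma evAt_der_eq_zero (v : ℤ × ℕ → O U) {F : O U} {p : U}
    (h : ∀ᶠ q in 𝓝 (p : Point), ev F q = 0) : evAt p (der v F) = 0 := by
  have : ev F =ᶠ[𝓝 (p : Point)] ev (0 : O U) := by
    filter_upwards [h, U.isOpen.mem_nhds p.2] with q hq hqU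
    rw [hq, ev_eq 0 ⟨q, hqU⟩, map_zero]
  rw [evAt_der_congr v this, map_zero, map_zero]

/-- A solution of `D_x c = A c + B` with `A`, `B` of order at most one in the derivatives depends
only on the variables `u_n`. -/
theorem jet_of_dx_eq {c A B : O U} (hc : dx U c = A * c + B)
    (hA : ∀ n k, dpd (n, k + 2) A = 0) (hB : ∀ n k, dpd (n, k + 2) B = 0) :
    (∀ n k, dpd (n, k + 1) c = 0) ∧
      ∀ n, dpd (n, 0) c = dpd (n, 1) A * c + A * dpd (n, 1) c + dpd (n, 1) B := by
  -- Differentiating the equation in `∂_x^{k+2} u_n` and commuting past `D_x` expresses each partial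
  -- derivative of `c` through that of the next order.
  have hrec : ∀ n k, dpd (n, k + 1) c =
      A * dpd (n, k + 2) c - dx U (dpd (n, k + 2) c) := by
    intro n k
    have h1 := dpd_succ_dx n (k + 1) c
    rw [hc, map_add, Derivation.leibniz, hA, hB] at h1
    simp only [smul_eq_mul] at h1
    linear_combination -h1
  have key : ∀ n k, dpd (n, k + 1) c = 0 := by
    intro n k
    refine O.ext_evAt fun p => ?_
    rw [map_zero]
    obtain ⟨S, g, hg⟩ := ev_locAnalyticAt c p.2
    -- Descending induction on the order, started beyond the finitely many variables on which `c`
    -- depends near `p`. Vanishing is carried on a neighbourhood because `hrec` applies `D_x` to the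
    -- vanishing function.
    have hlarge : ∀ j, (∀ s ∈ S, s.2 < j) → ∀ᶠ q in 𝓝 (p : Point), ev (dpd (n, j) c) q = 0 := by
      intro j hj
      filter_upwards [hg.eventually, U.isOpen.mem_nhds p.2] with q hq hqU
      rw [ev_eq _ ⟨q, hqU⟩, evAt_dpd]
      refine hq.pd_eq_zero ?_
      rintro s hs h
      have := hj s hs
      rw [← Sum.inl_injective h] at this
      exact lt_irrefl _ this
    have hstep : ∀ j, (∀ᶠ q in 𝓝 (p : Point), ev (dpd (n, j + 2) c) q = 0) →
        ∀ᶠ q in 𝓝 (p : Point), ev (dpd (n, j + 1) c) q = 0 := by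
      intro j hj
      filter_upwards [hj.eventually_nhds, U.isOpen.mem_nhds p.2] with q hq hqU
      have e0 : evAt ⟨q, hqU⟩ (dpd (n, j + 2) c) = 0 := by
        rw [← ev_eq]; exact hq.self_of_nhds
      rw [ev_eq _ ⟨q, hqU⟩, hrec, map_sub, map_mul, e0, dx, evAt_der_eq_zero _ hq]
      simp
    have hdown : ∀ i j, (∀ᶠ q in 𝓝 (p : Point), ev (dpd (n, j + 1 + i) c) q = 0) →
        ∀ᶠ q in 𝓝 (p : Point), ev (dpd (n, j + 1) c) q = 0 := by
      intro i
      induction i with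
      | zero => exact fun j h => h
      | succ i ih =>
        intro j h
        refine hstep j (ih (j + 1) ?_)
        rwa [show j + 1 + 1 + i = j + 1 + (i + 1) by ring]
    have h := hdown (S.sup Prod.snd + 1) k (hlarge _ fun s hs => by
      have : s.2 ≤ S.sup Prod.snd := Finset.le_sup (f := Prod.snd) hs
      omega)
    rw [← ev_eq]
    exact h.self_of_nhds
  refine ⟨key, fun n => ?_⟩
  have h1 := dpd_succ_dx n 0 c
  rw [key, map_zero, hc, map_add, Derivation.leibniz] at h1
  simp only [smul_eq_mul] at h1
  linear_combination -h1

/-! ### Restriction, division by nonvanishing functions and the identity theorem -/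

/-- Restriction to a smaller open set. -/
def res {V : Opens Point} (h : V ≤ U) (F : O U) : O V :=
  O.mk (ev F) fun _ hp => ev_locAnalyticAt F (h hp)

lemma evAt_res {V : Opens Point} (h : V ≤ U) (F : O U) (p : V) :
    evAt p (res h F) = evAt ⟨p, h p.2⟩ F := by
  rw [res, evAt_mk, ← ev_eq]

/-- The open set where a locally analytic function does not vanish. -/
def nonvan (F : O U) : Opens Point where
  carrier := {p | ∃ h : p ∈ U, evAt ⟨p, h⟩ F ≠ 0}
  is_open' := by
    rw [isOpen_iff_mem_nhds]
    rintro p ⟨hp, h0⟩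
    have hc := (ev_locAnalyticAt F hp).continuousAt
    have h1 : ev F p ≠ 0 := by rwa [ev_eq F ⟨p, hp⟩]
    filter_upwards [hc.eventually_ne h1, U.isOpen.mem_nhds hp] with q hq hqU
    exact ⟨hqU, by rwa [← ev_eq F ⟨q, hqU⟩]⟩

lemma nonvan_le (F : O U) : nonvan F ≤ U := fun _ h => h.1

lemma evAt_res_nonvan {V : Opens Point} (F : O U) (hV : V ≤ nonvan F) (h : V ≤ U) (p : V) :
    evAt p (res h F) ≠ 0 := by
  rw [evAt_res]
  exact (hV p.2).2

lemma exists_mul_eq_one {F : O U} (h : ∀ p : U, evAt p F ≠ 0) : ∃ G : O U, G * F = 1 := by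
  refine ⟨O.mk (fun q => (ev F q)⁻¹) fun p hp => (ev_locAnalyticAt F hp).inv ?_, ?_⟩
  · rw [ev_eq F ⟨p, hp⟩]; exact h _
  · refine O.ext_evAt fun p => ?_
    rw [map_mul, evAt_mk, ev_eq, map_one, inv_mul_cancel₀ (h p)]

lemma eq_zero_of_mul_eq_zero {F G : O U} (h : ∀ p : U, evAt p F ≠ 0) (h0 : F * G = 0) : G = 0 := by
  obtain ⟨H, hH⟩ := exists_mul_eq_one h
  linear_combination H * h0 - G * hH

/-- An analytic function on a connected set `D` that vanishes at the values of
`(u_{n+1}, u_n, u_{n-1})` on an open set of points vanishes on `D`. -/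
lemma eq_zero_of_tau_eq_zero {D : Set (ℂ × ℂ × ℂ)} (hD : IsPreconnected D) {F : An D} {n : ℤ}
    (p₀ : U) (h : ∀ p ∈ U, triple n p ∈ D) (h0 : tau n h F = 0) :
    ∀ q ∈ D, F.1 q = 0 := by
  -- A continuous section of `triple n` through `p₀`: it shows that the values taken over `U` fill a
  -- neighbourhood in `ℂ³`, so the identity theorem on `D` applies.
  let s : ℂ × ℂ × ℂ → Point := fun q => Function.update (Function.update (Function.update
    (p₀ : Point) (Sum.inl (n + 1, 0)) q.1) (Sum.inl (n, 0)) q.2.1) (Sum.inl (n - 1, 0)) q.2.2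
  have hs : Continuous s := by
    refine Continuous.update (Continuous.update (Continuous.update continuous_const _ ?_) _ ?_) _ ?_
    all_goals fun_prop
  have h1 : n - 1 ≠ n + 1 := by omega
  have h2 : n + 1 ≠ n - 1 := by omega
  have h3 : n ≠ n - 1 := by omega
  have hts : ∀ q, triple n (s q) = q := by
    intro q; simp [triple, ux, s, h2, h3]
  have hsp : s (triple n p₀) = p₀ := by
    have e1 : ∀ p : Point, s (triple n p₀) = p₀ := by
      intro p
      simp [triple, ux, s]
    exact e1 p₀
  have hnear : ∀ᶠ q in 𝓝 (triple n p₀), s q ∈ U :=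
    hs.continuousAt.eventually (by rw [hsp]; exact U.isOpen.mem_nhds p₀.2)
  have hz : F.1 =ᶠ[𝓝 (triple n p₀)] (fun _ => (0 : ℂ)) := by
    filter_upwards [hnear] with q hq
    have := congrArg (evAt ⟨s q, hq⟩) h0
    rwa [evAt_tau, map_zero, hts] at this
  exact fun q hq => AnalyticOnNhd.eqOn_of_preconnected_of_eventuallyEq F.2 analyticOnNhd_const hD
    (h _ p₀.2) hz hq

/-- A chain with coefficients analytic on a connected set `D`, where the derivatives of `α` in
`u_{n+1}` and `u_{n-1}` do not vanish identically. -/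
structure Setting where
  C : Chain
  D : Set (ℂ × ℂ × ℂ)
  conn : IsPreconnected D
  α : An D
  β : An D
  γ : An D
  δ : An D
  hα : α.1 = C.α
  hβ : β.1 = C.β
  hγ : γ.1 = C.γ
  hδ : δ.1 = C.δ
  αx_ne : ∃ q ∈ D, (px α).1 q ≠ 0
  αz_ne : ∃ q ∈ D, (pz α).1 q ≠ 0

namespace Setting

variable (E : Setting)

/-- The chain is defined over `U` for `n = 0, 1, 2`. -/
structure Dom (U : Opens Point) : Prop where
  h₀ : ∀ p ∈ U, triple 0 p ∈ E.D
  h₁ : ∀ p ∈ U, triple 1 p ∈ E.D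
  h₂ : ∀ p ∈ U, triple 2 p ∈ E.D

variable {E}

lemma Dom.mono {V : Opens Point} (h : E.Dom U) (hV : V ≤ U) : E.Dom V :=
  ⟨fun p hp => h.h₀ p (hV hp), fun p hp => h.h₁ p (hV hp), fun p hp => h.h₂ p (hV hp)⟩

lemma tau_px_ne {n : ℤ} (h : ∀ p ∈ U, triple n p ∈ E.D) (p₀ : U) : tau n h (px E.α) ≠ 0 := by
  intro h0
  obtain ⟨q, hq, hne⟩ := E.αx_ne
  exact hne (eq_zero_of_tau_eq_zero E.conn p₀ h h0 q hq)

lemma tau_pz_ne {n : ℤ} (h : ∀ p ∈ U, triple n p ∈ E.D) (p₀ : U) : tau n h (pz E.α) ≠ 0 := by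
  intro h0
  obtain ⟨q, hq, hne⟩ := E.αz_ne
  exact hne (eq_zero_of_tau_eq_zero E.conn p₀ h h0 q hq)

lemma exists_evAt_ne {F : O U} (h : F ≠ 0) : ∃ p : U, evAt p F ≠ 0 := by
  by_contra h'
  push Not at h'
  exact h (O.ext_evAt fun p => by rw [h' p, map_zero])

end Setting

/-! ### Differential equations in the `u_n` for the coefficients of relations -/

lemma dpd_tau {D : Set (ℂ × ℂ × ℂ)} (m n : ℤ) (h : ∀ p ∈ U, triple n p ∈ D) (F : An D) :
    dpd (m, 0) (tau n h F) = (if n + 1 = m then tau n h (px F) else 0)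
      + (if n = m then tau n h (py F) else 0) + (if n - 1 = m then tau n h (pz F) else 0) := by
  rw [(isVec_dpd _).tau, dpd_coord, dpd_coord, dpd_coord]
  simp only [Prod.mk.injEq, and_true, mul_ite, mul_one, mul_zero]

lemma dpd_succ_tau {D : Set (ℂ × ℂ × ℂ)} (m n : ℤ) (k : ℕ) (h : ∀ p ∈ U, triple n p ∈ D)
    (F : An D) : dpd (m, k + 1) (tau n h F) = 0 := by
  rw [(isVec_dpd _).tau, dpd_coord, dpd_coord, dpd_coord]
  simp

lemma yd_tau {D : Set (ℂ × ℂ × ℂ)} (m n : ℤ) (a : O U) (h : ∀ p ∈ U, triple n p ∈ D) (F : An D) :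
    yd m a (tau n h F) = (if n + 1 = m then tau n h (px F) else 0)
      + (if n = m then tau n h (py F) else 0) + (if n - 1 = m then tau n h (pz F) else 0) := by
  rw [(isVec_yd _ _).tau, yd_coord, yd_coord, yd_coord]
  simp only [jets, mul_ite, mul_one, mul_zero]

lemma yd_ad {D : Set (ℂ × ℂ × ℂ)} (m n : ℤ) (a : O U) (h : ∀ p ∈ U, triple n p ∈ D)
    (F G : An D) : yd m a (ad n h F G) = yd m a (tau n h F) * coord (n, 1)
      + (if n = m then tau n h F * a else 0) + yd m a (tau n h G) := by
  rw [ad, map_add, Derivation.leibniz, yd_coord]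
  simp only [jets_one, smul_eq_mul, mul_ite, mul_zero]
  ring

lemma dpd_succ_ad {D : Set (ℂ × ℂ × ℂ)} (m n : ℤ) (k : ℕ) (h : ∀ p ∈ U, triple n p ∈ D)
    (F G : An D) : dpd (m, k + 1) (ad n h F G) = if n = m ∧ k = 0 then tau n h F else 0 := by
  rw [ad, map_add, Derivation.leibniz, dpd_coord, dpd_succ_tau, dpd_succ_tau]
  simp [eq_comm]

namespace Setting

variable {E : Setting} (h : E.Dom U)

/-- The function `a_0`. -/
def a₀ (h : E.Dom U) : O U := ad 0 h.h₀ E.α E.γ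

/-- The function `a_1`. -/
def a₁ (h : E.Dom U) : O U := ad 1 h.h₁ E.α E.γ

/-- The function `a_2`. -/
def a₂ (h : E.Dom U) : O U := ad 2 h.h₂ E.α E.γ

lemma yd_zero_a₀ : yd 0 (a₀ h) (a₀ h) = tau 0 h.h₀ (py E.α) * coord (0, 1)
    + tau 0 h.h₀ E.α * a₀ h + tau 0 h.h₀ (py E.γ) := by
  conv_lhs => rw [a₀]
  rw [yd_ad, yd_tau, yd_tau]; simp [a₀]

lemma yd_zero_a₁ : yd 0 (a₀ h) (a₁ h) = tau 1 h.h₁ (pz E.α) * coord (1, 1)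
    + tau 1 h.h₁ (pz E.γ) := by
  rw [a₁, yd_ad, yd_tau, yd_tau]; simp

lemma yd_zero_a₂ : yd 0 (a₀ h) (a₂ h) = 0 := by
  rw [a₂, yd_ad, yd_tau, yd_tau]; simp

lemma yd_one_a₀ : yd 1 (a₁ h) (a₀ h) = tau 0 h.h₀ (px E.α) * coord (0, 1)
    + tau 0 h.h₀ (px E.γ) := by
  rw [a₀, yd_ad, yd_tau, yd_tau]; simp

lemma yd_one_a₁ : yd 1 (a₁ h) (a₁ h) = tau 1 h.h₁ (py E.α) * coord (1, 1)
    + tau 1 h.h₁ E.α * a₁ h + tau 1 h.h₁ (py E.γ) := by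
  conv_lhs => rw [a₁]
  rw [yd_ad, yd_tau, yd_tau]; simp [a₁]

lemma yd_one_a₂ : yd 1 (a₁ h) (a₂ h) = tau 2 h.h₂ (pz E.α) * coord (2, 1)
    + tau 2 h.h₂ (pz E.γ) := by
  rw [a₂, yd_ad, yd_tau, yd_tau]; norm_num

lemma yd_two_a₀ : yd 2 (a₂ h) (a₀ h) = 0 := by
  rw [a₀, yd_ad, yd_tau, yd_tau]; simp

/-- The vanishing relations express locality: `a_n` involves only `u_{n±1}, u_n, u_{n,x}`, and the
sites `0` and `2` are not neighbours. -/
lemma chainRelations : ChainRelations (dx U) (yd 0 (a₀ h)) (yd 1 (a₁ h)) (yd 2 (a₂ h))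
    (a₀ h) (a₁ h) (a₂ h) where
  lie₀ := dx_lie_yd _ _
  lie₁ := dx_lie_yd _ _
  lie₂ := dx_lie_yd _ _
  lie₂₀ := yd_lie_yd_eq_zero (yd_two_a₀ h) (yd_zero_a₂ h)
  y₂a₀ := yd_two_a₀ h
  y₀a₂ := yd_zero_a₂ h
  y₂y₁a₀ := by
    rw [yd_one_a₀, map_add, Derivation.leibniz, yd_tau, yd_tau, yd_coord]
    norm_num
  y₀y₁a₂ := by
    rw [yd_one_a₂, map_add, Derivation.leibniz, yd_tau, yd_tau, yd_coord]
    norm_num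

section Equations

/-- Here `∂c/∂u_2 = α_2 c` while `∂c/∂u_3 = 0`; the cross derivative leaves `(∂α_2/∂u_3) c = 0`. -/
lemma tau_px_mul_eq_zero {c : O U} (hc : dx U c = (a₂ h - a₁ h) * c) :
    tau 2 h.h₂ (px E.α) * c = 0 := by
  have := jet_of_dx_eq (B := 0) (by rw [hc, add_zero])
    (fun n k => by rw [map_sub, a₁, a₂, dpd_succ_ad, dpd_succ_ad]; simp) (by simp)
  obtain ⟨hj, h0⟩ := this
  have h2 : dpd (2, 0) c = tau 2 h.h₂ E.α * c := by
    rw [h0, hj, map_sub, a₁, a₂, dpd_succ_ad _ _ 0, dpd_succ_ad _ _ 0]; simp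
  have h3 : dpd (3, 0) c = 0 := by
    rw [h0, hj, map_sub, a₁, a₂, dpd_succ_ad _ _ 0, dpd_succ_ad _ _ 0]; simp
  have h4 := dpd_comm (3, 0) (2, 0) c
  rw [h2, h3, map_zero, Derivation.leibniz, h3, dpd_tau] at h4
  norm_num at h4
  linear_combination h4

/-- The mirror image, with `u_0` and `u_{-1}` in place of `u_2` and `u_3`. -/
lemma tau_pz_mul_eq_zero {c : O U} (hc : dx U c = (a₀ h - a₁ h) * c) :
    tau 0 h.h₀ (pz E.α) * c = 0 := by
  have := jet_of_dx_eq (B := 0) (by rw [hc, add_zero])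
    (fun n k => by rw [map_sub, a₀, a₁, dpd_succ_ad, dpd_succ_ad]; simp) (by simp)
  obtain ⟨hj, h0⟩ := this
  have h2 : dpd (0, 0) c = tau 0 h.h₀ E.α * c := by
    rw [h0, hj, map_sub, a₁, a₀, dpd_succ_ad _ _ 0, dpd_succ_ad _ _ 0]; simp
  have h3 : dpd (-1, 0) c = 0 := by
    rw [h0, hj, map_sub, a₁, a₀, dpd_succ_ad _ _ 0, dpd_succ_ad _ _ 0]; simp
  have h4 := dpd_comm (-1, 0) (0, 0) c
  rw [h2, h3, map_zero, Derivation.leibniz, h3, dpd_tau] at h4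
  norm_num at h4
  linear_combination h4

lemma dpd_linear {D : Set (ℂ × ℂ × ℂ)} (m n : ℤ) (k : ℕ) (h : ∀ p ∈ U, triple n p ∈ D)
    (F G : An D) : dpd (m, k + 1) (tau n h F * coord (n, 1) + tau n h G) =
      if n = m ∧ k = 0 then tau n h F else 0 := dpd_succ_ad m n k h F G

lemma dpd_quadratic {D : Set (ℂ × ℂ × ℂ)} (m n : ℤ) (k : ℕ) (h : ∀ p ∈ U, triple n p ∈ D)
    (F G H L : An D) :
    dpd (m, k + 1) (tau n h F * coord (n, 1) + tau n h H * ad n h H L + tau n h G) =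
      if n = m ∧ k = 0 then tau n h F + tau n h H ^ 2 else 0 := by
  rw [map_add, map_add, Derivation.leibniz, Derivation.leibniz, dpd_succ_tau, dpd_succ_tau,
    dpd_succ_tau, dpd_succ_ad, dpd_coord]
  simp only [Prod.mk.injEq, smul_eq_mul, mul_zero, add_zero]
  by_cases hc : n = m ∧ k = 0
  · obtain ⟨rfl, rfl⟩ := hc; simp; ring
  · have : ¬ (n = m ∧ 1 = k + 1) := by omega
    simp [hc]

lemma lambda_equations {l : O U} (hl : dx U l + a₀ h * l - yd 0 (a₀ h) (a₁ h) = 0) :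
    tau 0 h.h₀ (pz E.α) * l = 0 ∧ dpd (1, 0) l = tau 1 h.h₁ (pz E.α) := by
  have := jet_of_dx_eq (c := l) (A := - a₀ h) (B := yd 0 (a₀ h) (a₁ h))
    (by linear_combination hl)
    (fun n k => by rw [map_neg, a₀, dpd_succ_ad]; simp)
    (fun n k => by rw [yd_zero_a₁, dpd_linear]; simp)
  obtain ⟨hj, h0⟩ := this
  have e : ∀ n, dpd (n, 0) l = -(if (0 : ℤ) = n then tau 0 h.h₀ E.α else 0) * l
      + if (1 : ℤ) = n then tau 1 h.h₁ (pz E.α) else 0 := by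
    intro n
    rw [h0, hj, yd_zero_a₁, dpd_linear _ _ 0, map_neg, a₀, dpd_succ_ad _ _ 0]; simp
  have h2 := e 0
  have h3 := e (-1)
  have h5 := e 1
  norm_num at h2 h3 h5
  refine ⟨?_, h5⟩
  have h4 := dpd_comm (-1, 0) (0, 0) l
  rw [h2, h3, map_zero, map_neg, Derivation.leibniz, h3, dpd_tau] at h4
  norm_num at h4
  linear_combination h4

/-- Once `c` depends on the `u_n` only, its derivatives are read off from the `u_{n,x}`-coefficients
of the equation. The part free of `u_{n,x}` is not used. -/
lemma first_equations {c : O U} {K M : ℕ}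
    (hc : dx U c + a₀ h * c + K * yd 0 (a₀ h) (a₀ h) + M * yd 0 (a₀ h) (a₁ h) = 0) :
    dpd (-1, 0) c = 0 ∧ dpd (2, 0) c = 0 ∧ dpd (1, 0) c = - (M * dpd (0, 0) (tau 1 h.h₁ E.α)) ∧
    dpd (0, 0) c = - (tau 0 h.h₀ E.α * c) -
      K * (dpd (0, 0) (tau 0 h.h₀ E.α) + tau 0 h.h₀ E.α ^ 2) := by
  have hB : ∀ n k, dpd (n, k + 1) (-((K : O U) * yd 0 (a₀ h) (a₀ h) + (M : O U) * yd 0 (a₀ h) (a₁ h))) =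
      -(K * (if (0 : ℤ) = n ∧ k = 0 then tau 0 h.h₀ (py E.α) + tau 0 h.h₀ E.α ^ 2 else 0)
      + M * (if (1 : ℤ) = n ∧ k = 0 then tau 1 h.h₁ (pz E.α) else 0)) := by
    intro n k
    rw [map_neg, map_add, Derivation.leibniz, Derivation.leibniz, yd_zero_a₁, dpd_linear,
      yd_zero_a₀, a₀, dpd_quadratic]
    simp
  have := jet_of_dx_eq (c := c) (A := - a₀ h)
    (B := -((K : O U) * yd 0 (a₀ h) (a₀ h) + (M : O U) * yd 0 (a₀ h) (a₁ h)))
    (by linear_combination hc)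
    (fun n k => by rw [map_neg, a₀, dpd_succ_ad]; simp)
    (fun n k => by rw [hB]; simp)
  obtain ⟨hj, h0⟩ := this
  have e : ∀ n, dpd (n, 0) c = -(if (0 : ℤ) = n then tau 0 h.h₀ E.α else 0) * c
      - (K * (if (0 : ℤ) = n then tau 0 h.h₀ (py E.α) + tau 0 h.h₀ E.α ^ 2 else 0)
      + M * (if (1 : ℤ) = n then tau 1 h.h₁ (pz E.α) else 0)) := by
    intro n
    rw [h0, hj, hB _ 0, map_neg, a₀, dpd_succ_ad _ _ 0]; simp; ring
  have e1 := e (-1)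
  have e2 := e 2
  have e3 := e 1
  have e4 := e 0
  norm_num at e1 e2 e3 e4
  refine ⟨e1, e2, ?_, ?_⟩
  · rw [e3, dpd_tau]; norm_num
  · rw [e4, dpd_tau]; norm_num

lemma nu_equations {v : O U} {K m : ℕ}
    (hv : dx U v + a₁ h * v + K * yd 1 (a₁ h) (a₁ h) + m * yd 1 (a₁ h) (a₀ h + a₂ h) = 0) :
    dpd (0, 0) v = - (m * dpd (1, 0) (tau 0 h.h₀ E.α)) ∧
    dpd (2, 0) v = - (m * dpd (1, 0) (tau 2 h.h₂ E.α)) ∧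
    dpd (1, 0) v = - (tau 1 h.h₁ E.α * v) -
      K * (dpd (1, 0) (tau 1 h.h₁ E.α) + tau 1 h.h₁ E.α ^ 2) := by
  have hB : ∀ n k, dpd (n, k + 1) (-((K : O U) * yd 1 (a₁ h) (a₁ h) + (m : O U) * yd 1 (a₁ h) (a₀ h + a₂ h))) =
      -(K * (if (1 : ℤ) = n ∧ k = 0 then tau 1 h.h₁ (py E.α) + tau 1 h.h₁ E.α ^ 2 else 0)
      + m * ((if (0 : ℤ) = n ∧ k = 0 then tau 0 h.h₀ (px E.α) else 0) +
        (if (2 : ℤ) = n ∧ k = 0 then tau 2 h.h₂ (pz E.α) else 0))) := by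
    intro n k
    rw [map_neg, map_add, Derivation.leibniz, Derivation.leibniz, map_add, yd_one_a₀, yd_one_a₂,
      map_add, dpd_linear, dpd_linear, yd_one_a₁, a₁, dpd_quadratic]
    simp
  have := jet_of_dx_eq (c := v) (A := - a₁ h)
    (B := -((K : O U) * yd 1 (a₁ h) (a₁ h) + (m : O U) * yd 1 (a₁ h) (a₀ h + a₂ h)))
    (by linear_combination hv)
    (fun n k => by rw [map_neg, a₁, dpd_succ_ad]; simp)
    (fun n k => by rw [hB]; simp)
  obtain ⟨hj, h0⟩ := this
  have e : ∀ n, dpd (n, 0) v = -(if (1 : ℤ) = n then tau 1 h.h₁ E.α else 0) * v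
      - (K * (if (1 : ℤ) = n then tau 1 h.h₁ (py E.α) + tau 1 h.h₁ E.α ^ 2 else 0)
      + m * ((if (0 : ℤ) = n then tau 0 h.h₀ (px E.α) else 0) +
        (if (2 : ℤ) = n then tau 2 h.h₂ (pz E.α) else 0))) := by
    intro n
    rw [h0, hj, hB _ 0, map_neg, a₁, dpd_succ_ad _ _ 0]; simp; ring
  have e1 := e 0
  have e2 := e 2
  have e3 := e 1
  norm_num at e1 e2 e3
  refine ⟨?_, ?_, ?_⟩
  · rw [e1, dpd_tau]; norm_num
  · rw [e2, dpd_tau]; norm_num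
  · rw [e3, dpd_tau]; norm_num

end Equations

end Setting

/-! ### Compatibility conditions and the Liouville equation -/

section Algebra

variable {R : Type*} [CommRing R] [Algebra ℂ R]

lemma eq_zero_of_natCast_mul {n : ℕ} (hn : n ≠ 0) {x : R} (h : (n : R) * x = 0) : x = 0 := by
  have h1 : ((n : ℂ)⁻¹ * (n : ℂ)) • x = 0 := by
    rw [mul_smul, Algebra.smul_def (n : ℂ), map_natCast, h, smul_zero]
  rwa [inv_mul_cancel₀ (Nat.cast_ne_zero.2 hn), one_smul] at h1

lemma der_natCast_mul (T : Derivation ℂ R R) (n : ℕ) (x : R) : T ((n : R) * x) = n * T x := by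
  simp

lemma der_two (T : Derivation ℂ R R) : T (2 : R) = 0 := mod_cast T.map_natCast 2

variable {em e₀ e₁ e₂ : Derivation ℂ R R} {p q r c : R} {K m : ℕ}

/-- Here `em, e₀, e₁` stand for the derivatives in `u_{-1}, u_0, u_1`, and `p, q` for `α_0, α_1`.
Cross derivatives of `c` give two linear expressions for `c`; differentiating each once more and
eliminating `c` leaves the Liouville equations for `em p` and `e₁ p`. -/
lemma first_sequence_algebra
    (hm0 : ∀ x, em (e₀ x) = e₀ (em x)) (hm1 : ∀ x, em (e₁ x) = e₁ (em x))
    (h01 : ∀ x, e₀ (e₁ x) = e₁ (e₀ x)) (hK : 2 * K = (m + 1) * m)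
    (hmc : em c = 0) (h1 : e₁ c = -(((m + 1 : ℕ) : R) * e₀ q))
    (h0 : e₀ c = -(p * c) - (K : R) * (e₀ p + p ^ 2)) (hx : e₁ (em p) = 0)
    (hp : ∀ x, em p * x = 0 → x = 0) :
    e₀ q = m * e₁ p ∧
    (K : R) * (em p * em (em (e₀ p)) - em (em p) * em (e₀ p) + 2 * em p ^ 3) = 0 ∧
    (K : R) * (e₁ p * e₁ (e₁ (e₀ p)) - e₁ (e₁ p) * e₁ (e₀ p) + 2 * e₁ p ^ 3) = 0 := by
  have hK' : 2 * (K : R) = ((m + 1 : ℕ) : R) * m := by exact_mod_cast congrArg (Nat.cast (R := R)) hK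
  have i1 : em p * c + K * (em (e₀ p) + 2 * p * em p) = 0 := by
    have := hm0 c
    rw [hmc, map_zero, h0] at this
    simp only [map_sub, map_neg, Derivation.leibniz, Derivation.leibniz_pow, map_add, smul_eq_mul,
      Derivation.map_natCast, hmc] at this
    simp at this
    linear_combination -this
  -- Differentiate `i1` in `u_1`: since `e₁ (em p) = 0`, everything left is a multiple of `em p`,
  -- which may be cancelled.
  have i2 : e₁ c + 2 * K * e₁ p = 0 := by
    apply hp
    have := congrArg e₁ i1
    simp only [Derivation.leibniz, map_add, smul_eq_mul, Derivation.map_natCast, der_two, map_zero] at this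
    rw [← hm1 (e₀ p), ← h01, hm0 (e₁ p), hm1 p, hx] at this
    simp at this
    linear_combination this
  have i3 := congrArg em i1
  simp only [Derivation.leibniz, map_add, smul_eq_mul, Derivation.map_natCast, der_two, map_zero, hmc] at i3
  have i4 := h01 c
  have e1c : e₁ c = -(2 * K * e₁ p) := by linear_combination i2
  rw [e1c, h0] at i4
  simp only [map_sub, map_neg, Derivation.leibniz, Derivation.leibniz_pow, map_add, smul_eq_mul,
      Derivation.map_natCast, der_two, e1c, h01 p] at i4
  simp at i3 i4
  have i5 : e₁ p * c = K * e₁ (e₀ p) := by linear_combination i4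
  have i6 := congrArg e₁ i5
  simp only [Derivation.leibniz, smul_eq_mul, Derivation.map_natCast, e1c] at i6
  refine ⟨?_, ?_, ?_⟩
  · have : ((m + 1 : ℕ) : R) * (e₀ q - m * e₁ p) = 0 := by
      linear_combination h1 - i2 + e₁ p * hK'
    exact sub_eq_zero.1 (eq_zero_of_natCast_mul (Nat.succ_ne_zero m) this)
  · linear_combination em p * i3 - em (em p) * i1
  · linear_combination -e₁ p * i6 + e₁ (e₁ p) * i5

/-- With `r` for `α_2` and `c` for `ν_k`: the equality of `e₀ (e₁ c)` and `e₁ (e₀ c)` still contains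
`c`, and applying `e₂` replaces `c` by the known `e₂ c`. -/
lemma second_sequence_algebra
    (h01 : ∀ x, e₀ (e₁ x) = e₁ (e₀ x)) (h12 : ∀ x, e₁ (e₂ x) = e₂ (e₁ x))
    (hK : 2 * K = (m + 1) * m)
    (h0 : e₀ c = -((m : R) * e₁ p)) (h2 : e₂ c = -((m : R) * e₁ r))
    (h1 : e₁ c = -(q * c) - (K : R) * (e₁ q + q ^ 2)) (hx : e₂ (e₀ q) = 0) (hp : e₂ p = 0)
    (hpq : e₀ q = e₁ p) :
    (m : R) * (e₁ p * (e₁ r - m * e₂ q)) = 0 := by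
  have hK' : 2 * (K : R) = ((m + 1 : ℕ) : R) * m := by exact_mod_cast congrArg (Nat.cast (R := R)) hK
  have i1 := h01 c
  rw [h1, h0] at i1
  have i2 := congrArg e₂ i1
  have hpp : e₂ (e₁ (e₁ p)) = 0 := by rw [← h12, ← h12, hp]; simp
  have hqq : e₂ (e₀ (e₁ q)) = 0 := by rw [h01, ← h12, hx, map_zero]
  have h12p : e₂ (e₁ p) = 0 := by rw [← h12, hp, map_zero]
  simp only [map_sub, map_neg, Derivation.leibniz, Derivation.leibniz_pow, map_add, smul_eq_mul,
      Derivation.map_natCast, h0, h2, hx, hpp, hqq, h12p] at i2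
  simp [hx, der_two] at i2
  rw [hpq] at i2
  push_cast at hK'
  linear_combination i2 + e₂ q * e₁ p * hK'

/-- Both `v = e₁ p` and `m v` satisfy the Liouville equation. The logarithmic part scales by `m²`
and the cubic term by `m³`, so the difference is `2 m² (m - 1) v³`. -/
lemma liouville_ratio (h01 : ∀ x, e₀ (e₁ x) = e₁ (e₀ x)) (hpq : e₀ q = (m : R) * e₁ p)
    (hz : e₀ q * e₀ (e₀ (e₁ q)) - e₀ (e₀ q) * e₀ (e₁ q) + 2 * e₀ q ^ 3 = 0)
    (hx : e₁ p * e₁ (e₁ (e₀ p)) - e₁ (e₁ p) * e₁ (e₀ p) + 2 * e₁ p ^ 3 = 0) :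
    (m : R) ^ 2 * ((m : R) - 1) * e₁ p ^ 3 = 0 := by
  have hd : ∀ (T : Derivation ℂ R R) x, T ((m : R) * x) = m * T x := fun T x => by simp
  have a1 : e₀ (e₁ q) = m * e₁ (e₁ p) := by rw [h01, hpq, hd]
  have a2 : e₀ (e₀ (e₁ q)) = m * e₁ (e₁ (e₀ p)) := by rw [a1, hd, h01, h01]
  have a3 : e₀ (e₀ q) = m * e₁ (e₀ p) := by rw [hpq, hd, h01]
  have h2 : 2 * ((m : R) ^ 2 * ((m : R) - 1) * e₁ p ^ 3) = 0 := by
    rw [a2, a1, a3, hpq] at hz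
    linear_combination hz - (m : R) ^ 2 * hx
  exact eq_zero_of_natCast_mul (n := 2) (by norm_num) (by exact_mod_cast h2)

end Algebra

/-! ### Expansions of vector fields as relations between derivations -/

section Relations

variable {V : Opens Point} {Zv : ℕ → VField} {Zd : ℕ → Derivation ℂ (O U) (O U)}
  {N : ℕ}

lemma isVec_sum_smul (hZ : ∀ m, Represents (Zv m) (Zd m)) (c : ℕ → O U) :
    IsVec (∑ i ∈ Finset.range N, c i • Zd i) :=
  IsVec.sum _ fun i _ => (hZ i).isVec.smul _

lemma evAt_sum_smul (hZ : ∀ m, Represents (Zv m) (Zd m)) (c : ℕ → O U) (s : ℤ × ℕ) (p : U) :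
    evAt p ((∑ i ∈ Finset.range N, c i • Zd i) (coord s)) =
      ∑ i ∈ Finset.range N, evAt p (c i) * Zv i (Sum.inl s) p := by
  have hsum : (∑ i ∈ Finset.range N, c i • Zd i) (coord s) =
      ∑ i ∈ Finset.range N, (c i • Zd i) (coord s) := by
    have := map_sum (Derivation.coeFnAddMonoidHom (R := ℂ) (A := O U) (M := O U))
      (fun i => c i • Zd i) (Finset.range N)
    exact (congrFun this (coord s)).trans (Finset.sum_apply _ _ _)
  rw [hsum, map_sum]
  refine Finset.sum_congr rfl fun i _ => ?_
  rw [Derivation.smul_apply, smul_eq_mul, map_mul, (hZ i).inl]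

lemma exists_lift {c : ℕ → Point → ℂ} (hc : ∀ i < N, LocAnalyticOn (c i) U) :
    ∃ C : ℕ → O U, ∀ i < N, ∀ p : U, evAt p (C i) = c i p := by
  classical
  exact ⟨fun i => if h : i < N then O.mk (c i) (hc i h) else 0, fun i hi p => by
    simp only [hi, dite_true]; rfl⟩

lemma exists_of_isExpansionOn (hZ : ∀ m, Represents (Zv m) (Zd m)) {c : ℕ → Point → ℂ}
    (hc : IsExpansionOn U Zv N c) :
    ∃ C : ℕ → O U, (∀ i < N, ∀ p : U, evAt p (C i) = c i p) ∧
      Zd N = ∑ i ∈ Finset.range N, C i • Zd i := by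
  obtain ⟨C, hC⟩ := exists_lift hc.1
  refine ⟨C, hC, (hZ N).isVec.ext (isVec_sum_smul hZ C) fun s => O.ext_evAt fun p => ?_⟩
  rw [evAt_sum_smul hZ, ← (hZ N).inl, hc.2 p p.2]
  exact Finset.sum_congr rfl fun i hi => by rw [hC i (Finset.mem_range.1 hi)]

lemma isExpansionOn_of_eq (hZ : ∀ m, Represents (Zv m) (Zd m)) {C : ℕ → O U}
    (hC : Zd N = ∑ i ∈ Finset.range N, C i • Zd i) :
    IsExpansionOn U Zv N (fun i => ev (C i)) := by
  refine ⟨fun i _ p hp => ev_locAnalyticAt (C i) hp, fun p hp w => ?_⟩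
  cases w with
  | inl s =>
    have := (hZ N).inl s ⟨p, hp⟩
    rw [hC, evAt_sum_smul hZ] at this
    rw [this]
    exact Finset.sum_congr rfl fun i _ => by rw [← ev_eq]
  | inr n =>
    rw [(hZ N).inr n ⟨p, hp⟩]
    exact (Finset.sum_eq_zero fun i _ => by rw [(hZ i).inr n ⟨p, hp⟩, mul_zero]).symm

lemma IsExpansionOn.mono {c : ℕ → Point → ℂ} (h : IsExpansionOn U Zv N c) (hV : V ≤ U) :
    IsExpansionOn V Zv N c :=
  ⟨fun i hi p hp => h.1 i hi p (hV hp), fun p hp => h.2 p (hV hp)⟩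

lemma LinIndepOn.mono (h : LinIndepOn U Zv N) (hV : V ≤ U) : LinIndepOn V Zv N :=
  fun W hW => h W (hW.trans hV)

lemma LinIndepOn.eq_zero (hZ : ∀ m, Represents (Zv m) (Zd m)) (h : LinIndepOn U Zv (N + 1)) {x : O U}
    (hx : x • Zd N ∈ low Zd N) : x = 0 := by
  obtain ⟨c, hc⟩ := mem_low_iff.1 hx
  have key := h U subset_rfl U.isOpen (fun i => if i = N then - ev x else ev (c i)) ?_ ?_ N
    (Nat.lt_succ_self N)
  · refine O.ext_evAt fun p => ?_
    have := key p p.2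
    simp only [if_true, Pi.neg_apply, neg_eq_zero] at this
    rw [← ev_eq, this, map_zero]
  · intro i _ p hp
    by_cases hi : i = N
    · have : LocAnalyticAt (ev (-x)) p := ev_locAnalyticAt _ hp
      simp only [hi, if_true]
      refine this.congr ?_
      filter_upwards [U.isOpen.mem_nhds hp] with q hq
      rw [Pi.neg_apply, ev_eq _ ⟨q, hq⟩, ev_eq _ ⟨q, hq⟩, map_neg]
    · simp only [hi, if_false]; exact ev_locAnalyticAt (c i) hp
  · intro p hp w
    have hsum : ∑ i ∈ Finset.range N, (if i = N then - ev x else ev (c i)) p * Zv i w p =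
        ∑ i ∈ Finset.range N, ev (c i) p * Zv i w p := by
      refine Finset.sum_congr rfl fun i hi => ?_
      rw [if_neg (Finset.mem_range.1 hi).ne]
    rw [Finset.sum_range_succ, hsum]
    simp only [if_true, Pi.neg_apply]
    cases w with
    | inl s =>
      have := evAt_sum_smul (N := N) hZ c s ⟨p, hp⟩
      rw [hc, Derivation.smul_apply, smul_eq_mul, map_mul, ← (hZ N).inl] at this
      simp only [ev_eq _ ⟨p, hp⟩]
      rw [← this]
      ring
    | inr n =>
      rw [(hZ N).inr n ⟨p, hp⟩, mul_zero, add_zero]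
      exact Finset.sum_eq_zero fun i _ => by rw [(hZ i).inr n ⟨p, hp⟩, mul_zero]

lemma res_sum_smul (hV : V ≤ U) {Zd' : ℕ → Derivation ℂ (O V) (O V)}
    (hZ : ∀ m, Represents (Zv m) (Zd m)) (hZ' : ∀ m, Represents (Zv m) (Zd' m)) {c : ℕ → O U}
    (hc : ∑ i ∈ Finset.range N, c i • Zd i = 0) :
    ∑ i ∈ Finset.range N, res hV (c i) • Zd' i = 0 := by
  refine (isVec_sum_smul hZ' _).ext isVec_zero fun s => O.ext_evAt fun p => ?_
  have := evAt_sum_smul (N := N) hZ c s ⟨p, hV p.2⟩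
  rw [hc, Derivation.zero_apply, map_zero] at this
  rw [evAt_sum_smul hZ', Derivation.zero_apply, map_zero, this]
  exact Finset.sum_congr rfl fun i _ => by rw [evAt_res]

end Relations

section LowMem

variable {A : Type*} [CommRing A] [Algebra ℂ A] {Z : ℕ → Derivation ℂ A A} {N : ℕ}

lemma sum_smul_mem_low (c : ℕ → A) : ∑ i ∈ Finset.range N, c i • Z i ∈ low Z N :=
  mem_low_iff.2 ⟨c, rfl⟩

/-- A combination `x Z_N + …` of the first members of a sequence as a sum. -/
lemma exists_sum_of_mem_low {x : A} (h : x • Z N ∈ low Z N) :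
    ∃ c : ℕ → A, c N = x ∧ ∑ i ∈ Finset.range (N + 1), c i • Z i = 0 := by
  obtain ⟨c, hc⟩ := mem_low_iff.1 h
  refine ⟨fun i => if i = N then x else - c i, by simp, ?_⟩
  rw [Finset.sum_range_succ]
  have : ∑ i ∈ Finset.range N, (if i = N then x else - c i) • Z i =
      - ∑ i ∈ Finset.range N, c i • Z i := by
    rw [← Finset.sum_neg_distrib]
    refine Finset.sum_congr rfl fun i hi => ?_
    rw [if_neg (Finset.mem_range.1 hi).ne, neg_smul]
  rw [this, hc]
  simp

lemma exists_sum_of_mem_low₂ {x y : A} (h : y • Z (N + 1) + x • Z N ∈ low Z N) :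
    ∃ c : ℕ → A, c N = x ∧ ∑ i ∈ Finset.range (N + 2), c i • Z i = 0 := by
  obtain ⟨c, hc⟩ := mem_low_iff.1 h
  refine ⟨fun i => if i = N + 1 then y else if i = N then x else - c i, by simp, ?_⟩
  rw [Finset.sum_range_succ, Finset.sum_range_succ]
  have : ∑ i ∈ Finset.range N, (if i = N + 1 then y else if i = N then x else - c i) • Z i =
      - ∑ i ∈ Finset.range N, c i • Z i := by
    rw [← Finset.sum_neg_distrib]
    refine Finset.sum_congr rfl fun i hi => ?_
    have := Finset.mem_range.1 hi
    rw [if_neg (by omega), if_neg (by omega), neg_smul]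
  rw [this, hc]
  simp

lemma exists_sum_of_mem_low₃ {x y z : A} (h : z • Z (N + 2) + y • Z (N + 1) + x • Z N ∈ low Z N) :
    ∃ c : ℕ → A, c N = x ∧ ∑ i ∈ Finset.range (N + 3), c i • Z i = 0 := by
  obtain ⟨c, hc⟩ := mem_low_iff.1 h
  refine ⟨fun i => if i = N + 2 then z else if i = N + 1 then y else if i = N then x else - c i,
    by simp, ?_⟩
  rw [Finset.sum_range_succ, Finset.sum_range_succ, Finset.sum_range_succ]
  have : ∑ i ∈ Finset.range N,
      (if i = N + 2 then z else if i = N + 1 then y else if i = N then x else - c i) • Z i =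
      - ∑ i ∈ Finset.range N, c i • Z i := by
    rw [← Finset.sum_neg_distrib]
    refine Finset.sum_congr rfl fun i hi => ?_
    have := Finset.mem_range.1 hi
    rw [if_neg (by omega), if_neg (by omega), if_neg (by omega), neg_smul]
  rw [this, hc]
  simp

end LowMem

/-! ### The coefficient of `Z_{3m+2}` in relations among the `Z_s` -/

namespace Setting

variable {E : Setting}

/-- The sequence `Z_m` as derivations. -/
def Z (h : E.Dom U) : ℕ → Derivation ℂ (O U) (O U) :=
  zseq (yd 0 (a₀ h)) (yd 1 (a₁ h)) (yd 2 (a₂ h))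

/-- The sequence `Y_0, Y_1, W_1, …` as derivations. -/
def W (h : E.Dom U) : ℕ → Derivation ℂ (O U) (O U) := wseq (yd 0 (a₀ h)) (yd 1 (a₁ h))

variable (h : E.Dom U)

lemma represents₀ : Represents (E.C.Yi 0) (yd 0 (a₀ h)) :=
  represents_Yi h.h₀ E.α E.β E.γ E.δ E.hα E.hβ E.hγ E.hδ

lemma represents₁ : Represents (E.C.Yi 1) (yd 1 (a₁ h)) :=
  represents_Yi h.h₁ E.α E.β E.γ E.δ E.hα E.hβ E.hγ E.hδ

lemma represents₂ : Represents (E.C.Yi 2) (yd 2 (a₂ h)) :=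
  represents_Yi h.h₂ E.α E.β E.γ E.δ E.hα E.hβ E.hγ E.hδ

lemma represents_seqZ : ∀ m, Represents (E.C.seqZ m) (Z h m)
  | 0 => represents₀ h
  | 1 => represents₁ h
  | 2 => represents₂ h
  | 3 => (represents₁ h).bracket (represents₀ h)
  | 4 => (represents₂ h).bracket (represents₁ h)
  | 5 => (represents₂ h).bracket ((represents₁ h).bracket (represents₀ h))
  | m + 6 => (represents₁ h).bracket (represents_seqZ (m + 3))

lemma represents_seqW : ∀ m, Represents (E.C.seqW m) (W h m)
  | 0 => represents₀ h
  | 1 => represents₁ h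
  | m + 2 => (represents₀ h).bracket (represents_seqW (m + 1))

/-- None of the operators `Z_{3j+2}`, `j < k`, is a combination of the previous ones on any part
of `U`. -/
def Irreducible (E : Setting) (U : Opens Point) (k : ℕ) : Prop :=
  ∀ j < k, ∀ V : Opens Point, V ≤ U → (V : Set Point).Nonempty →
    ¬ ∃ d : ℕ → Point → ℂ, IsExpansionOn V E.C.seqZ (3 * j + 2) d

variable {h} {k : ℕ}

lemma Irreducible.mono {V : Opens Point} (hk : E.Irreducible U k) (hV : V ≤ U) :
    E.Irreducible V k := fun j hj W hW => hk j hj W (hW.trans hV)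

/-- Where the coefficient does not vanish, division by it would expand `Z_{3m+2}` on a nonempty open
set. -/
lemma Irreducible.top_two (hk : E.Irreducible U k) (h : E.Dom U) {m : ℕ} (hm : m < k) {c : ℕ → O U}
    (hc : ∑ i ∈ Finset.range (3 * m + 3), c i • Z h i = 0) : c (3 * m + 2) = 0 := by
  by_contra hne
  obtain ⟨p, hp⟩ := exists_evAt_ne hne
  have hV := nonvan_le (c (3 * m + 2))
  have hc' := res_sum_smul hV (represents_seqZ h) (represents_seqZ (h.mono hV)) hc
  obtain ⟨u, hu⟩ := exists_mul_eq_one (evAt_res_nonvan (c (3 * m + 2)) le_rfl hV)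
  refine hk m hm _ hV ⟨p, p.2, hp⟩ ⟨_, isExpansionOn_of_eq (represents_seqZ (h.mono hV))
    (C := fun i => -(u * res hV (c i))) ?_⟩
  rw [Finset.sum_range_succ] at hc'
  have e := congrArg (fun x => u • x) (eq_neg_of_add_eq_zero_right hc')
  simp only [smul_smul, hu, one_smul, smul_neg, Finset.smul_sum] at e
  rw [e, ← Finset.sum_neg_distrib]
  exact Finset.sum_congr rfl fun i _ => (neg_smul _ _).symm

/-- If the coefficient of `Z_{3m+3}` vanishes this is `top_two`. Otherwise solve for `Z_{3m+3}` on a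
smaller open set: the coefficient of `Z_{3m+2}` satisfies `D_x c = (a_2 - a_1) c`, which
`tau_px_mul_eq_zero` forbids for nonvanishing `c`. -/
lemma Irreducible.top_three (hk : E.Irreducible U k) (h : E.Dom U) {m : ℕ} (hm1 : 1 ≤ m) (hm : m < k)
    {c : ℕ → O U} (hc : ∑ i ∈ Finset.range (3 * m + 4), c i • Z h i = 0) : c (3 * m + 2) = 0 := by
  by_contra hne
  obtain ⟨p, hp⟩ := exists_evAt_ne hne
  have hV := nonvan_le (c (3 * m + 2))
  have hc' := res_sum_smul hV (represents_seqZ h) (represents_seqZ (h.mono hV)) hc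
  by_cases h3 : res hV (c (3 * m + 3)) = 0
  · rw [Finset.sum_range_succ, h3, zero_smul, add_zero] at hc'
    have := (hk.mono hV).top_two (h.mono hV) hm hc'
    have h2 := evAt_res_nonvan (c (3 * m + 2)) le_rfl hV ⟨p, p.2, hp⟩
    rw [this, map_zero] at h2
    exact h2 rfl
  · obtain ⟨q, hq⟩ := exists_evAt_ne h3
    have hV' := nonvan_le (res hV (c (3 * m + 3)))
    have hVU := hV'.trans hV
    have hD := h.mono hVU
    have hc'' := res_sum_smul hVU (represents_seqZ h) (represents_seqZ hD) hc
    obtain ⟨u, hu⟩ := exists_mul_eq_one (F := res hVU (c (3 * m + 3))) fun r => by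
      have := r.2.2
      rwa [evAt_res] at this ⊢
    have hx : ∀ r, evAt r (res hVU (c (3 * m + 2))) ≠ 0 := evAt_res_nonvan _ hV' hVU
    rw [Finset.sum_range_succ, Finset.sum_range_succ] at hc''
    have hmem : Z hD (3 * m + 3) - (-(u * res hVU (c (3 * m + 2)))) • Z hD (3 * m + 2) ∈
        low (Z hD) (3 * m + 2) := by
      have e := congrArg (fun x => u • x) hc''
      simp only [smul_zero, smul_add, smul_smul, hu, one_smul] at e
      have h1 := Submodule.neg_mem _ (Submodule.smul_mem _ u
        (sum_smul_mem_low (N := 3 * m + 2) (Z := Z hD) fun i => res hVU (c i)))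
      convert h1 using 1
      rw [← sub_eq_zero]
      simp only [neg_smul, sub_neg_eq_add]
      rw [← e]
      abel
    have h5 := (chainRelations hD).relation_zero hm1 hmem
    obtain ⟨c₂, hc₂, hs⟩ := exists_sum_of_mem_low h5
    have h6 := (hk.mono hVU).top_two hD hm hs
    rw [hc₂, sub_eq_zero] at h6
    have h7 := tau_px_mul_eq_zero hD h6
    have h8 : res hVU (c (3 * m + 2)) * (tau 2 hD.h₂ (px E.α)) = 0 := by
      linear_combination -res hVU (c (3 * m + 3)) * h7 -
        tau 2 hD.h₂ (px E.α) * res hVU (c (3 * m + 2)) * hu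
    exact tau_px_ne hD.h₂ ⟨q, q.2, hq⟩ (eq_zero_of_mul_eq_zero hx h8)

/-- The same argument one step higher, with `D_x e = (a_0 - a_1) e`; the unknown multiple of
`Z_{3m+3}` is absorbed by `top_three`. -/
lemma Irreducible.top_four (hk : E.Irreducible U k) (h : E.Dom U) {m : ℕ} (hm1 : 1 ≤ m) (hm : m < k)
    {c : ℕ → O U} (hc : ∑ i ∈ Finset.range (3 * m + 5), c i • Z h i = 0) : c (3 * m + 2) = 0 := by
  by_contra hne
  obtain ⟨p, hp⟩ := exists_evAt_ne hne
  have hV := nonvan_le (c (3 * m + 2))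
  have hc' := res_sum_smul hV (represents_seqZ h) (represents_seqZ (h.mono hV)) hc
  by_cases h3 : res hV (c (3 * m + 4)) = 0
  · rw [Finset.sum_range_succ, h3, zero_smul, add_zero] at hc'
    have := (hk.mono hV).top_three (h.mono hV) hm1 hm hc'
    have h2 := evAt_res_nonvan (c (3 * m + 2)) le_rfl hV ⟨p, p.2, hp⟩
    rw [this, map_zero] at h2
    exact h2 rfl
  · obtain ⟨q, hq⟩ := exists_evAt_ne h3
    have hV' := nonvan_le (res hV (c (3 * m + 4)))
    have hVU := hV'.trans hV
    have hD := h.mono hVU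
    have hc'' := res_sum_smul hVU (represents_seqZ h) (represents_seqZ hD) hc
    obtain ⟨u, hu⟩ := exists_mul_eq_one (F := res hVU (c (3 * m + 4))) fun r => by
      have := r.2.2
      rwa [evAt_res] at this ⊢
    have hx : ∀ r, evAt r (res hVU (c (3 * m + 2))) ≠ 0 := evAt_res_nonvan _ hV' hVU
    rw [Finset.sum_range_succ, Finset.sum_range_succ, Finset.sum_range_succ] at hc''
    have hmem : Z hD (3 * m + 4) - (-(u * res hVU (c (3 * m + 3)))) • Z hD (3 * m + 3)
        - (-(u * res hVU (c (3 * m + 2)))) • Z hD (3 * m + 2) ∈ low (Z hD) (3 * m + 2) := by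
      have e := congrArg (fun x => u • x) hc''
      simp only [smul_zero, smul_add, smul_smul, hu, one_smul] at e
      have h1 := Submodule.neg_mem _ (Submodule.smul_mem _ u
        (sum_smul_mem_low (N := 3 * m + 2) (Z := Z hD) fun i => res hVU (c i)))
      convert h1 using 1
      rw [← sub_eq_zero]
      simp only [neg_smul, sub_neg_eq_add]
      rw [← e]
      abel
    obtain ⟨y, h5⟩ := (chainRelations hD).relation_one hm1 hmem
    obtain ⟨c₂, hc₂, hs⟩ := exists_sum_of_mem_low₂ h5
    have h6 := (hk.mono hVU).top_three hD hm1 hm hs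
    rw [hc₂, sub_eq_zero] at h6
    have h7 := tau_pz_mul_eq_zero hD h6
    have h8 : res hVU (c (3 * m + 2)) * (tau 0 hD.h₀ (pz E.α)) = 0 := by
      linear_combination -res hVU (c (3 * m + 4)) * h7 -
        tau 0 hD.h₀ (pz E.α) * res hVU (c (3 * m + 2)) * hu
    exact tau_pz_ne hD.h₀ ⟨q, q.2, hq⟩ (eq_zero_of_mul_eq_zero hx h8)

/-- The equation for the coefficient of `Z_{3k-1}`. -/
lemma Irreducible.nu_equation (hk : E.Irreducible U k) (h : E.Dom U) {m : ℕ} (hm1 : 1 ≤ m) (hm : m < k)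
    {c : ℕ → O U} (hc : Z h (3 * m + 5) = ∑ i ∈ Finset.range (3 * m + 5), c i • Z h i) :
    dx U (c (3 * m + 2)) + a₁ h * c (3 * m + 2) + ((m + 1).choose 2 : O U) * yd 1 (a₁ h) (a₁ h)
      + m * yd 1 (a₁ h) (a₀ h + a₂ h) = 0 := by
  have hmem : Z h (3 * m + 5) - c (3 * m + 4) • Z h (3 * m + 4) - c (3 * m + 3) • Z h (3 * m + 3)
      - c (3 * m + 2) • Z h (3 * m + 2) ∈ low (Z h) (3 * m + 2) := by
    rw [Finset.sum_range_succ, Finset.sum_range_succ, Finset.sum_range_succ] at hc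
    convert sum_smul_mem_low (N := 3 * m + 2) (Z := Z h) c using 1
    rw [hc]
    abel
  obtain ⟨x, y, h1⟩ := (chainRelations h).relation_two hm1 hmem
  obtain ⟨c₂, hc₂, hs⟩ := exists_sum_of_mem_low₃ h1
  have h2 := hk.top_four h hm1 hm hs
  rw [← hc₂, h2]

end Setting

/-! ### Determination of `M` and `k` -/

/-- The Liouville equation for `∂_z F`. -/
def liouvilleZ {D : Set (ℂ × ℂ × ℂ)} (F : An D) : An D :=
  pz F * pz (pz (py F)) - pz (pz F) * pz (py F) + 2 * pz F ^ 3

/-- The Liouville equation for `∂_x F`. -/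
def liouvilleX {D : Set (ℂ × ℂ × ℂ)} (F : An D) : An D :=
  px F * px (px (py F)) - px (px F) * px (py F) + 2 * px F ^ 3

section

variable {n : ℤ} (h : ∀ p ∈ U, triple n p ∈ D) (F : An D)

lemma dpd_tau_self : dpd (n, 0) (tau n h F) = tau n h (py F) := by
  rw [dpd_tau]; simp

lemma dpd_tau_next {m : ℤ} (hm : n + 1 = m) : dpd (m, 0) (tau n h F) = tau n h (px F) := by
  rw [dpd_tau, if_pos hm, if_neg (by omega), if_neg (by omega), add_zero, add_zero]

lemma dpd_tau_prev {m : ℤ} (hm : n - 1 = m) : dpd (m, 0) (tau n h F) = tau n h (pz F) := by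
  rw [dpd_tau, if_pos hm, if_neg (by omega), if_neg (by omega), zero_add, zero_add]

lemma tau_liouvilleZ {m : ℤ} (hm : n - 1 = m) : tau n h (liouvilleZ F) =
    dpd (m, 0) (tau n h F) * dpd (m, 0) (dpd (m, 0) (dpd (n, 0) (tau n h F)))
      - dpd (m, 0) (dpd (m, 0) (tau n h F)) * dpd (m, 0) (dpd (n, 0) (tau n h F))
      + 2 * dpd (m, 0) (tau n h F) ^ 3 := by
  have h2 : tau n h (2 : An D) = 2 := map_ofNat _ 2
  simp only [dpd_tau_self, dpd_tau_prev _ _ hm, liouvilleZ, map_add, map_sub, map_mul, map_pow, h2]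

lemma tau_liouvilleX {m : ℤ} (hm : n + 1 = m) : tau n h (liouvilleX F) =
    dpd (m, 0) (tau n h F) * dpd (m, 0) (dpd (m, 0) (dpd (n, 0) (tau n h F)))
      - dpd (m, 0) (dpd (m, 0) (tau n h F)) * dpd (m, 0) (dpd (n, 0) (tau n h F))
      + 2 * dpd (m, 0) (tau n h F) ^ 3 := by
  have h2 : tau n h (2 : An D) = 2 := map_ofNat _ 2
  simp only [dpd_tau_self, dpd_tau_next _ _ hm, liouvilleX, map_add, map_sub, map_mul, map_pow, h2]

end

namespace Setting

variable {E : Setting} (h : E.Dom U)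

lemma tau_eq_zero {D : Set (ℂ × ℂ × ℂ)} {F : An D} (hF : ∀ q ∈ D, F.1 q = 0) (n : ℤ)
    (h : ∀ p ∈ U, triple n p ∈ D) : tau n h F = 0 :=
  O.ext_evAt fun p => by rw [evAt_tau, hF _ (h p p.2), map_zero]

lemma two_mul_choose (m : ℕ) : 2 * (m + 1).choose 2 = (m + 1) * m := by
  rw [Nat.choose_two_right, Nat.add_sub_cancel]
  exact Nat.mul_div_cancel' (by rw [mul_comm]; exact (Nat.even_mul_succ_self m).two_dvd)

lemma eq_one_of_mul_cube {m : ℕ} (hm : m ≠ 0) {F : O U} (hF : F ≠ 0)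
    (h0 : (m : O U) ^ 2 * ((m : O U) - 1) * F ^ 3 = 0) : m = 1 := by
  obtain ⟨p, hp⟩ := exists_evAt_ne hF
  have h1 := congrArg (evAt p) h0
  simp only [map_mul, map_pow, map_natCast, map_sub, map_one, map_zero, mul_eq_zero,
    pow_eq_zero_iff, ne_eq, OfNat.ofNat_ne_zero, not_false_eq_true, hp, or_false,
    Nat.cast_eq_zero, hm, false_or] at h1
  exact_mod_cast sub_eq_zero.1 h1

/-- The consequences of the termination of the first sequence. -/
theorem first_conclusion (p₀ : U) (hz : ∀ p, evAt p (tau 0 h.h₀ (pz E.α)) ≠ 0) {m : ℕ} {c : O U}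
    (hc : dx U c + a₀ h * c + ((m + 1).choose 2 : O U) * yd 0 (a₀ h) (a₀ h) +
      ((m + 1 : ℕ) : O U) * yd 0 (a₀ h) (a₁ h) = 0) :
    m = 1 ∧ tau 1 h.h₁ (pz E.α) = tau 0 h.h₀ (px E.α) ∧ tau 1 h.h₁ (px (pz E.α)) = 0 ∧
    (∀ q ∈ E.D, (liouvilleZ E.α).1 q = 0) ∧ ∀ q ∈ E.D, (liouvilleX E.α).1 q = 0 := by
  obtain ⟨hm1, h2, h1, h0⟩ := first_equations h hc
  have e0q : dpd (0, 0) (tau 1 h.h₁ E.α) = tau 1 h.h₁ (pz E.α) :=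
    dpd_tau_prev _ _ (by norm_num)
  have emp : dpd (-1, 0) (tau 0 h.h₀ E.α) = tau 0 h.h₀ (pz E.α) :=
    dpd_tau_prev _ _ (by norm_num)
  have e1p : dpd (1, 0) (tau 0 h.h₀ E.α) = tau 0 h.h₀ (px E.α) :=
    dpd_tau_next _ _ (by norm_num)
  have hxz : tau 1 h.h₁ (px (pz E.α)) = 0 := by
    have := dpd_comm (2, 0) (1, 0) c
    rw [h2, h1, map_zero, map_neg, der_natCast_mul, e0q, dpd_tau] at this
    norm_num at this
    exact eq_zero_of_natCast_mul (Nat.succ_ne_zero m) (by push_cast; exact this)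
  have hxzD := eq_zero_of_tau_eq_zero E.conn p₀ h.h₁ hxz
  have hx : dpd (1, 0) (dpd (-1, 0) (tau 0 h.h₀ E.α)) = 0 := by
    rw [emp, dpd_tau, tau_eq_zero hxzD 0 h.h₀]; norm_num
  obtain ⟨r1, r2, r3⟩ := first_sequence_algebra (em := dpd (-1, 0)) (e₀ := dpd (0, 0))
    (e₁ := dpd (1, 0)) (fun x => dpd_comm _ _ x) (fun x => dpd_comm _ _ x)
    (fun x => dpd_comm _ _ x) (two_mul_choose m) hm1 h1 h0 hx (fun x hx => by
      rw [emp] at hx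
      exact eq_zero_of_mul_eq_zero hz hx)
  have hm : m ≠ 0 := by
    rintro rfl
    rw [Nat.cast_zero, zero_mul, e0q] at r1
    exact tau_pz_ne h.h₁ p₀ r1
  have hK : (m + 1).choose 2 ≠ 0 := (Nat.choose_pos (by omega)).ne'
  have hLZ : ∀ q ∈ E.D, (liouvilleZ E.α).1 q = 0 := by
    refine eq_zero_of_tau_eq_zero E.conn p₀ h.h₀ ?_
    rw [tau_liouvilleZ h.h₀ _ (m := -1) (by norm_num)]
    exact eq_zero_of_natCast_mul hK r2
  have hLX : ∀ q ∈ E.D, (liouvilleX E.α).1 q = 0 := by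
    refine eq_zero_of_tau_eq_zero E.conn p₀ h.h₀ ?_
    rw [tau_liouvilleX h.h₀ _ (m := 1) (by norm_num)]
    exact eq_zero_of_natCast_mul hK r3
  -- Proved at `n = 0`, the Liouville equation holds on all of `D` and may be used at `n = 1`, where
  -- its variables `u_1, u_0` are those of the equation for `∂α_0/∂u_1`.
  have hq := tau_eq_zero hLZ 1 h.h₁
  rw [tau_liouvilleZ h.h₁ _ (m := 0) (by norm_num)] at hq
  have hfin := liouville_ratio (e₀ := dpd (0, 0)) (e₁ := dpd (1, 0)) (fun x => dpd_comm _ _ x) r1 hq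
    (eq_zero_of_natCast_mul hK r3)
  rw [e1p] at hfin
  have hm1 := eq_one_of_mul_cube hm (tau_px_ne h.h₀ p₀) hfin
  refine ⟨hm1, ?_, hxz, hLZ, hLX⟩
  rw [hm1, Nat.cast_one, one_mul, e0q, e1p] at r1
  exact r1

/-- The consequences of the equation for the coefficient of `Z_{3k-1}`. -/
theorem second_conclusion (p₀ : U) (hx : ∀ p, evAt p (tau 0 h.h₀ (px E.α)) ≠ 0)
    (hpq : tau 1 h.h₁ (pz E.α) = tau 0 h.h₀ (px E.α)) (hxz : tau 1 h.h₁ (px (pz E.α)) = 0)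
    (hLZ : ∀ q ∈ E.D, (liouvilleZ E.α).1 q = 0) (hLX : ∀ q ∈ E.D, (liouvilleX E.α).1 q = 0)
    {m : ℕ} (hm : m ≠ 0) {v : O U}
    (hv : dx U v + a₁ h * v + ((m + 1).choose 2 : O U) * yd 1 (a₁ h) (a₁ h)
      + m * yd 1 (a₁ h) (a₀ h + a₂ h) = 0) : m = 1 := by
  obtain ⟨h0, h2, h1⟩ := nu_equations h hv
  have e0q : dpd (0, 0) (tau 1 h.h₁ E.α) = tau 1 h.h₁ (pz E.α) :=
    dpd_tau_prev _ _ (by norm_num)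
  have e2q : dpd (2, 0) (tau 1 h.h₁ E.α) = tau 1 h.h₁ (px E.α) :=
    dpd_tau_next _ _ (by norm_num)
  have e1p : dpd (1, 0) (tau 0 h.h₀ E.α) = tau 0 h.h₀ (px E.α) :=
    dpd_tau_next _ _ (by norm_num)
  have e1r : dpd (1, 0) (tau 2 h.h₂ E.α) = tau 2 h.h₂ (pz E.α) :=
    dpd_tau_prev _ _ (by norm_num)
  have key := second_sequence_algebra (e₀ := dpd (0, 0)) (e₁ := dpd (1, 0)) (e₂ := dpd (2, 0))
    (fun x => dpd_comm _ _ x) (fun x => dpd_comm _ _ x) (two_mul_choose m) h0 h2 h1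
    (by rw [e0q, dpd_tau, hxz]; norm_num) (by rw [dpd_tau]; norm_num) (by rw [e0q, e1p, hpq])
  have key2 := eq_zero_of_natCast_mul hm key
  rw [e1p] at key2
  have key3 := sub_eq_zero.1 (eq_zero_of_mul_eq_zero hx key2)
  have hZ := tau_eq_zero hLZ 2 h.h₂
  rw [tau_liouvilleZ h.h₂ _ (m := 1) (by norm_num)] at hZ
  have hX := tau_eq_zero hLX 1 h.h₁
  rw [tau_liouvilleX h.h₁ _ (m := 2) (by norm_num)] at hX
  have hfin := liouville_ratio (e₀ := dpd (1, 0)) (e₁ := dpd (2, 0)) (fun x => dpd_comm _ _ x) key3 hZ hX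
  rw [e2q] at hfin
  exact eq_one_of_mul_cube hm (tau_px_ne h.h₁ p₀) hfin

/-- The coefficient at `u_2` removes `Z_2`; the one at `u_{2,x}` then gives `x Y_1(a_2) = 0`. As
`Y_1(a_2)` is affine in `u_{2,x}` with slope `∂α_2/∂u_1`, it vanishes on no nonempty open set. -/
lemma top_zseq_four {x : O U} (hx : x • Z h 4 ∈ low (Z h) 4) : x = 0 := by
  obtain ⟨c, hc⟩ := mem_low_iff.1 hx
  have h1 := congrArg (fun T : Derivation ℂ (O U) (O U) => T (coord (2, 0))) hc
  have h2 := congrArg (fun T : Derivation ℂ (O U) (O U) => T (coord (2, 1))) hc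
  simp only [Finset.sum_range_succ, Finset.sum_range_zero, zero_add, Derivation.add_apply,
    Derivation.smul_apply, Z, zseq, Derivation.commutator_apply, yd_coord, smul_eq_mul] at h1 h2
  norm_num [jets] at h1 h2
  have h3 : x * yd 1 (a₁ h) (a₂ h) = 0 := by
    rw [h1] at h2
    linear_combination h2
  by_contra hne
  obtain ⟨p, hp⟩ := exists_evAt_ne hne
  have hD := h.mono (nonvan_le x)
  have h4 : tau 2 hD.h₂ (pz E.α) * coord (2, 1) + tau 2 hD.h₂ (pz E.γ) = 0 := by
    refine O.ext_evAt fun q => ?_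
    have h5 := congrArg (evAt ⟨q, nonvan_le x q.2⟩) h3
    rw [map_mul, map_zero, mul_eq_zero] at h5
    have h6 := h5.resolve_left q.2.2
    rw [yd_one_a₂] at h6
    simpa [evAt_tau] using h6
  have h5 := congrArg (dpd (2, 1)) h4
  rw [dpd_linear _ _ 0, map_zero] at h5
  exact tau_pz_ne hD.h₂ ⟨p, p.2, hp⟩ (by simpa using h5)

/-- Among `Z_0, …, Z_5` only `Z_2` has a nonzero coefficient at `∂/∂u_2`. -/
lemma coeff_two_eq_zero {c : ℕ → O U} (hc : Z h 5 = ∑ i ∈ Finset.range 5, c i • Z h i) :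
    c 2 = 0 := by
  have h1 := congrArg (fun T : Derivation ℂ (O U) (O U) => T (coord (2, 0))) hc
  simp only [Finset.sum_range_succ, Finset.sum_range_zero, zero_add, Derivation.add_apply,
    Derivation.smul_apply, Z, zseq, Derivation.commutator_apply, yd_coord, smul_eq_mul] at h1
  norm_num [jets] at h1
  exact h1.symm

/-- The coefficient `λ` of `Z_4` satisfies `D_x λ = -a_0 λ + Y_0(a_1)`. Cross derivatives in `u_0,
u_{-1}` force `λ = 0`, against `∂λ/∂u_1 = ∂α_1/∂u_0`. -/
lemma no_expansion_five (p₀ : U) (hz : ∀ p, evAt p (tau 0 h.h₀ (pz E.α)) ≠ 0) {c : ℕ → O U}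
    (hc : Z h 5 = ∑ i ∈ Finset.range 5, c i • Z h i) : False := by
  have hmem : Z h 5 - c 4 • Z h 4 ∈ low (Z h) 4 := by
    rw [hc, Finset.sum_range_succ, add_sub_cancel_right]
    exact sum_smul_mem_low c
  have h1 := top_zseq_four h ((chainRelations h).relation_five hmem)
  obtain ⟨h2, h3⟩ := lambda_equations h h1
  rw [eq_zero_of_mul_eq_zero hz h2, map_zero] at h3
  exact tau_pz_ne h.h₁ p₀ h3.symm

lemma exists_good (h : E.Dom U) (p₀ : U) : ∃ (V : Opens Point) (_ : V ≤ U) (hV : E.Dom V),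
    Nonempty V ∧ (∀ p, evAt p (tau 0 hV.h₀ (pz E.α)) ≠ 0) ∧
      ∀ p, evAt p (tau 0 hV.h₀ (px E.α)) ≠ 0 := by
  obtain ⟨p, hp⟩ := exists_evAt_ne (tau_pz_ne h.h₀ p₀)
  have hD := h.mono (nonvan_le (tau 0 h.h₀ (pz E.α)))
  obtain ⟨q, hq⟩ := exists_evAt_ne (tau_px_ne hD.h₀ ⟨p, p.2, hp⟩)
  refine ⟨nonvan (tau 0 hD.h₀ (px E.α)), (nonvan_le _).trans (nonvan_le _),
    hD.mono (nonvan_le _), ⟨q, q.2, hq⟩, fun r => ?_, fun r => r.2.2⟩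
  exact (nonvan_le _ r.2).2

lemma W_relation {m : ℕ} {c : ℕ → O U}
    (hind : LinIndepOn U E.C.seqW (m + 2))
    (hc : W h (m + 2) = ∑ i ∈ Finset.range (m + 2), c i • W h i) :
    dx U (c (m + 1)) + a₀ h * c (m + 1) + ((m + 1).choose 2 : O U) * yd 0 (a₀ h) (a₀ h) +
      ((m + 1 : ℕ) : O U) * yd 0 (a₀ h) (a₁ h) = 0 := by
  have hmem : W h (m + 2) - c (m + 1) • W h (m + 1) ∈ low (W h) (m + 1) := by
    rw [hc, Finset.sum_range_succ, add_sub_cancel_right]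
    exact sum_smul_mem_low c
  have h1 := wseq_relation (chainRelations h).lie₀ (chainRelations h).lie₁ hmem
  have h2 := hind.eq_zero (represents_seqW h) h1
  push_cast
  exact h2

theorem eq_two_of_terminates {k M : ℕ} (h : E.Dom U) (p₀ : U) (hk1 : 1 ≤ k) {c e : ℕ → Point → ℂ}
    (hexp : IsExpansionOn U E.C.seqZ (3 * k + 2) c) (hirr : E.Irreducible U k)
    (hind : LinIndepOn U E.C.seqW (M + 1)) (hW : IsExpansionOn U E.C.seqW (M + 1) e) :
    M = 2 ∧ k = 2 := by
  obtain ⟨V, hVU, hV, ⟨p⟩, hz, hx⟩ := exists_good h p₀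
  obtain ⟨e', -, he⟩ := exists_of_isExpansionOn (represents_seqW hV) (hW.mono hVU)
  obtain ⟨c', -, hc⟩ := exists_of_isExpansionOn (represents_seqZ hV) (hexp.mono hVU)
  cases M with
  -- For `M = 0` the expansion would read `Y_1 = e Y_0`, which fails at `∂/∂u_1`.
  | zero =>
    have h1 := congrArg (fun T : Derivation ℂ (O V) (O V) => evAt p (T (coord (1, 0)))) he
    simp [W, wseq, yd_coord, jets] at h1
  | succ m =>
    have hrel := W_relation hV (hind.mono hVU) he
    obtain ⟨rfl, hpq, hxz, hLZ, hLX⟩ := first_conclusion hV p hz hrel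
    refine ⟨rfl, ?_⟩
    obtain ⟨n, rfl⟩ : ∃ n, k = n + 1 := ⟨k - 1, by omega⟩
    have hn : n ≠ 0 := by
      rintro rfl
      exact no_expansion_five hV p hz hc
    have hv := (hirr.mono hVU).nu_equation hV (m := n) (by omega) (Nat.lt_succ_self n) hc
    rw [second_conclusion hV p hx hpq hxz hLZ hLX hn hv]

theorem one_le_of_expansion {k : ℕ} (h : E.Dom U) (p₀ : U) {c : ℕ → Point → ℂ}
    (hexp : IsExpansionOn U E.C.seqZ (3 * k + 2) c) : 1 ≤ k := by
  by_contra hk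
  obtain rfl : k = 0 := by omega
  obtain ⟨c', -, hc⟩ := exists_of_isExpansionOn (represents_seqZ h) hexp
  have h1 := congrArg (fun T : Derivation ℂ (O U) (O U) => evAt p₀ (T (coord (2, 0)))) hc
  simp [Finset.sum_range_succ, Z, zseq, yd_coord, jets] at h1

theorem nu_equation_apply {k : ℕ} (h : E.Dom U) (hk1 : 1 ≤ k) {c : ℕ → Point → ℂ}
    (hexp : IsExpansionOn U E.C.seqZ (3 * k + 2) c) (hirr : E.Irreducible U k) (p : U) :
    act E.C.Dx (c (3 * k - 1)) p = - E.C.a 1 p * c (3 * k - 1) p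
        - (k : ℂ) * ((k : ℂ) - 1) / 2 * act (E.C.Yi 1) (E.C.a 1) p
        - ((k : ℂ) - 1) * act (E.C.Yi 1) (E.C.a 0 + E.C.a 2) p := by
  obtain ⟨c', hc', hc⟩ := exists_of_isExpansionOn (represents_seqZ h) hexp
  obtain ⟨m, rfl⟩ : ∃ n, k = n + 1 := ⟨k - 1, by omega⟩
  rw [show 3 * (m + 1) - 1 = 3 * m + 2 by omega]
  have hν : dx U (c' (3 * m + 2)) + a₁ h * c' (3 * m + 2) +
      ((m + 1).choose 2 : O U) * yd 1 (a₁ h) (a₁ h) + m * yd 1 (a₁ h) (a₀ h + a₂ h) = 0 := by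
    -- For `k = 1` the weight argument is not available, since `Z_2` is exceptional; but there `ν_1
    -- = 0` and the equation is homogeneous.
    rcases Nat.eq_zero_or_pos m with rfl | hm
    · rw [coeff_two_eq_zero h hc]
      simp
    · exact hirr.nu_equation h hm (Nat.lt_succ_self m) hc
  have ea₀ : ∀ q, evAt q (a₀ h) = E.C.a 0 q := evAt_ad h.h₀ _ _ E.hα E.hγ
  have ea₁ : ∀ q, evAt q (a₁ h) = E.C.a 1 q := evAt_ad h.h₁ _ _ E.hα E.hγ
  have ea₂ : ∀ q, evAt q (a₂ h) = E.C.a 2 q := evAt_ad h.h₂ _ _ E.hα E.hγ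
  have hcm : ∀ q, evAt q (c' (3 * m + 2)) = c (3 * m + 2) q := hc' _ (by omega)
  have r₁ := represents₁ h
  rw [act_Dx E.C (ev_eventuallyEq hcm p.2).symm,
    r₁.isVec.evAt (fun s => r₁.inl s p) (ev_eventuallyEq ea₁ p.2).symm,
    r₁.isVec.evAt (fun s => r₁.inl s p) (F := a₀ h + a₂ h)
      (ev_eventuallyEq (fun q => by rw [map_add, ea₀, ea₂]; rfl) p.2).symm]
  have h1 := congrArg (evAt p) hν
  simp only [map_add, map_mul, map_natCast, map_zero, ea₁, hcm] at h1 ⊢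
  rw [Nat.cast_choose_two] at h1
  push_cast at h1 ⊢
  linear_combination h1

end Setting

end QuasilinearChain

end

theorem theorem2 (C : QuasilinearChain.Chain) (D : Set (ℂ × ℂ × ℂ))
    (hD : IsOpen D) (hDc : IsConnected D)
    (hα : AnalyticOnNhd ℂ C.α D) (hβ : AnalyticOnNhd ℂ C.β D)
    (hγ : AnalyticOnNhd ℂ C.γ D) (hδ : AnalyticOnNhd ℂ C.δ D)
    -- the derivatives of `α` in `u_{n+1}` and in `u_{n-1}` do not vanish identically
    (hα₁ : ∃ q ∈ D, deriv (fun t : ℂ => C.α (t, q.2.1, q.2.2)) q.1 ≠ 0)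
    (hα₃ : ∃ q ∈ D, deriv (fun t : ℂ => C.α (q.1, q.2.1, t)) q.2.2 ≠ 0)
    -- an open set of values of the dynamical variables, over which the chain is defined at 0, 1, 2
    (U : Set QuasilinearChain.Point) (hU : IsOpen U) (hUne : U.Nonempty)
    (hUD : ∀ p ∈ U, ∀ n ∈ ({0, 1, 2} : Set ℤ), QuasilinearChain.triple n p ∈ D)
    (k : ℕ) (c : ℕ → QuasilinearChain.Point → ℂ)
    (hexp : QuasilinearChain.IsExpansionOn U C.seqZ (3 * k + 2) c)
    (hfirst : ∀ j < k, ∀ V ⊆ U, IsOpen V → V.Nonempty →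
      ¬ ∃ d : ℕ → QuasilinearChain.Point → ℂ,
        QuasilinearChain.IsExpansionOn V C.seqZ (3 * j + 2) d) :
    1 ≤ k ∧
    (∀ p ∈ U, QuasilinearChain.act C.Dx (c (3 * k - 1)) p =
      - C.a 1 p * c (3 * k - 1) p
        - (k : ℂ) * ((k : ℂ) - 1) / 2 * QuasilinearChain.act (C.Yi 1) (C.a 1) p
        - ((k : ℂ) - 1) * QuasilinearChain.act (C.Yi 1) (C.a 0 + C.a 2) p) ∧
    (∀ (M : ℕ) (e : ℕ → QuasilinearChain.Point → ℂ),
      QuasilinearChain.LinIndepOn U C.seqW (M + 1) →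
      QuasilinearChain.IsExpansionOn U C.seqW (M + 1) e →
      M = 2 ∧ k = 2) := by

  let E : QuasilinearChain.Setting :=
    { C := C, D := D, conn := hDc.isPreconnected
      α := ⟨C.α, hα⟩, β := ⟨C.β, hβ⟩, γ := ⟨C.γ, hγ⟩, δ := ⟨C.δ, hδ⟩
      hα := rfl, hβ := rfl, hγ := rfl, hδ := rfl
      αx_ne := hα₁, αz_ne := hα₃ }
  let U' : TopologicalSpace.Opens QuasilinearChain.Point := ⟨U, hU⟩
  have h : E.Dom U' :=
    ⟨fun p hp => hUD p hp 0 (by simp), fun p hp => hUD p hp 1 (by simp),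
      fun p hp => hUD p hp 2 (by simp)⟩
  obtain ⟨p₀, hp₀⟩ := hUne
  have hirr : E.Irreducible U' k := fun j hj V hV hVne => hfirst j hj V hV V.isOpen hVne
  have hk1 : 1 ≤ k := QuasilinearChain.Setting.one_le_of_expansion h ⟨p₀, hp₀⟩ hexp
  exact ⟨hk1, fun p hp => QuasilinearChain.Setting.nu_equation_apply h hk1 hexp hirr ⟨p, hp⟩,
    fun M e hind hW =>
      QuasilinearChain.Setting.eq_two_of_terminates h ⟨p₀, hp₀⟩ hk1 hexp hirr hind hW⟩
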